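/- A weighted automaton $\mathcal A=(Q,A,\{M_c\}_{c\in A},I,F)$ over a finite alphabet $A$ and a commutative semiring $\mathbb S$ has a finite state set $Q$, matrices $M_c\in\mathbb S^{Q\times Q}$ and vectors $I,F\in\mathbb S^Q$; its output on $w=c_1\cdots c_n$ is $I^t M_{c_1}\cdots M_{c_n}F$. An accepting run over $w$ is a sequence of states $q_0,\dots,q_n$ with $I(q_0)\neq\mathbb 0$, $M_{c_i}(q_{i-1},q_i)\ne\mathbb 0$ for $1\le i\le n$, and $F(q_n)\neq\mathbb 0$. The automaton is unambiguous if every word has at most one accepting run, finitely ambiguous if the number of accepting runs is bounded by a constant, and polynomially ambiguous if it is bounded by a polynomial in the length of the word. Let U-WA, FA-WA, PA-WA, WA be the classes of functions $A^*\to\mathbb S$ defined by unambiguous, finitely ambiguous, polynomially ambiguous and arbitrary weighted automata. Let $\mathbb S$ be the min-plus semiring $(\mathbb N\cup\{+\infty\},\min,+,+\infty,0)$ or the max-plus semiring $(\mathbb N\cup\{-\infty\},\max,+,-\infty,0)$. Then, over both semirings and over every finite alphabet $A$, $\text{U-WA}\subseteq\text{FA-WA}\subseteq\text{PA-WA}\subseteq\text{WA}$.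 If $A$ has at least three letters, then over both semirings $$\text{U-WA}\subsetneq\text{FA-WA}\subsetneq\text{PA-WA}\subsetneq\text{WA},$$ and the first two inclusions are already strict if $A$ has at least two letters. The following functions of a word $w=c_1\cdots c_n$ over $A$ witness this, where $a,b,\#\in A$ are any distinct letters ($a,b$ distinct suffices for those in which $\#$ does not occur) and $w=w_0\#w_1\#\cdots\#w_k$ is the factorisation of $w$ into words $w_i$ without $\#$. Over the min-plus semiring: - $f_2(w)=\min\{|w|_a,|w|_b\}$ is in FA-WA but not in U-WA; - $f_3(w)=\min_{0\le i\le n}\bigl(|c_1\cdots c_i|_a+|c_{i+1}\cdots c_n|_b\bigr)$ and $f_4(w)=$ the length of the shortest maximal non-empty block of $b$'s in $w$ ($+\infty$ if there is none) are in PA-WA but not in FA-WA; - $f_5(w)=\sum_i f_2(w_i)$ and $f_6(w)=\sum_i f_4(w_i)$ are in WA but not in PA-WA. Over the max-plus semiring: - $g_2(w)=\max\{|w|_a,|w|_b\}$ is in FA-WA but not in U-WA; - $g_3(w)=\max_{0\le i\le n}\bigl(|c_1\cdots c_i|_a+|c_{i+1}\cdots c_n|_b\bigr)$ and $g_4(w)=$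 the length of the longest block of $b$'s in $w$ ($-\infty$ if there is none) are in PA-WA but not in FA-WA; - $g_5(w)=\sum_i g_2(w_i)$ and $g_6(w)=\sum_i g_3(w_i)$ are in WA but not in PA-WA. -/

import Mathlib

open scoped Matrix

namespace WeightedAut

/-- The min-plus semiring `(ℕ ∪ {+∞}, min, +, +∞, 0)`: in `Tropical ℕ∞` the semiring addition is
`min`, the semiring multiplication is `+`, the semiring zero is `+∞` and the semiring one is `0`. -/
abbrev MinPlus : Type := Tropical ℕ∞

/-- The carrier `ℕ ∪ {-∞}` of the max-plus semiring. -/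
@[ext] structure MaxPlus : Type where
  /-- the element of `ℕ ∪ {-∞}` seen as an element of the max-plus semiring -/
  mk ::
  /-- the underlying element of `ℕ ∪ {-∞}` -/
  val : WithBot ℕ

namespace MaxPlus

instance : Zero MaxPlus := ⟨⟨⊥⟩⟩
instance : One MaxPlus := ⟨⟨0⟩⟩
instance : Add MaxPlus := ⟨fun x y => ⟨max x.val y.val⟩⟩
instance : Mul MaxPlus := ⟨fun x y => ⟨x.val + y.val⟩⟩

theorem val_zero : (0 : MaxPlus).val = ⊥ := rfl
theorem val_one : (1 : MaxPlus).val = 0 := rfl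
theorem val_add (x y : MaxPlus) : (x + y).val = max x.val y.val := rfl
theorem val_mul (x y : MaxPlus) : (x * y).val = x.val + y.val := rfl

/-- The max-plus semiring `(ℕ ∪ {-∞}, max, +, -∞, 0)`. -/
instance : CommSemiring MaxPlus where
  add_assoc x y z := by ext1; simp only [val_add, max_assoc]
  zero_add x := by ext1; simp [val_add, val_zero]
  add_zero x := by ext1; simp [val_add, val_zero]
  add_comm x y := by ext1; simp only [val_add, max_comm]
  mul_assoc x y z := by ext1; simp only [val_mul, add_assoc]
  one_mul x := by ext1; simp [val_mul, val_one]
  mul_one x := by ext1; simp [val_mul, val_one]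
  mul_comm x y := by ext1; simp only [val_mul, add_comm]
  zero_mul x := by ext1; simp [val_mul, val_zero]
  mul_zero x := by ext1; simp [val_mul, val_zero]
  left_distrib x y z := by ext1; simp only [val_mul, val_add, add_max]
  right_distrib x y z := by ext1; simp only [val_mul, val_add, max_add]
  nsmul := nsmulRec
  npow := npowRec

end MaxPlus

/-- A weighted automaton over the alphabet `A` and the semiring `S` with set of states `Q`
(which is required to be finite below): transition matrices, initial and final vector. -/
structure WeightedAutomaton (A S Q : Type*) where
  /-- the transition matrices -/
  M : A → Matrix Q Q S
  /-- the initial vector -/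
  I : Q → S
  /-- the final vector -/
  F : Q → S

namespace WeightedAutomaton

variable {A S Q : Type*} [CommSemiring S]

/-- The output `Iᵗ ⬝ M_{a₁} ⬝ ⋯ ⬝ M_{aₙ} ⬝ F` on the word `a₁ ⋯ aₙ`. -/
def output [Fintype Q] (𝒜 : WeightedAutomaton A S Q) (w : List A) : S :=
  w.foldl (fun x c => x ᵥ* 𝒜.M c) 𝒜.I ⬝ᵥ 𝒜.F

/-- The accepting runs over `w = a₁ ⋯ aₙ`. A run is given by its sequence `q₀, …, qₙ` of states,
which determines the transitions `(qᵢ₋₁, aᵢ, M_{aᵢ}(qᵢ₋₁, qᵢ), qᵢ)`. -/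
def acceptingRuns (𝒜 : WeightedAutomaton A S Q) (w : List A) :
    Set (Fin (w.length + 1) → Q) :=
  {ρ | 𝒜.I (ρ 0) ≠ 0 ∧ (∀ i : Fin w.length, 𝒜.M (w.get i) (ρ i.castSucc) (ρ i.succ) ≠ 0) ∧
    𝒜.F (ρ (Fin.last w.length)) ≠ 0}

/-- At most one accepting run over every word. -/
def Unambiguous (𝒜 : WeightedAutomaton A S Q) : Prop :=
  ∀ w, (𝒜.acceptingRuns w).ncard ≤ 1

/-- The number of accepting runs is uniformly bounded. -/
def FinitelyAmbiguous (𝒜 : WeightedAutomaton A S Q) : Prop :=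
  ∃ N : ℕ, ∀ w, (𝒜.acceptingRuns w).ncard ≤ N

/-- The number of accepting runs is bounded by a polynomial in the length of the word. -/
def PolynomiallyAmbiguous (𝒜 : WeightedAutomaton A S Q) : Prop :=
  ∃ p : Polynomial ℕ, ∀ w, (𝒜.acceptingRuns w).ncard ≤ p.eval w.length

end WeightedAutomaton

section Classes

variable (A S : Type*) [CommSemiring S]

/-- The class of recognisable functions. -/
def WA : Set (List A → S) :=
  {f | ∃ (Q : Type) (_ : Fintype Q) (𝒜 : WeightedAutomaton A S Q), ∀ w, f w = 𝒜.output w}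

/-- The class of unambiguously recognisable functions. -/
def UWA : Set (List A → S) :=
  {f | ∃ (Q : Type) (_ : Fintype Q) (𝒜 : WeightedAutomaton A S Q),
    𝒜.Unambiguous ∧ ∀ w, f w = 𝒜.output w}

/-- The class of finite-ambiguously recognisable functions. -/
def FAWA : Set (List A → S) :=
  {f | ∃ (Q : Type) (_ : Fintype Q) (𝒜 : WeightedAutomaton A S Q),
    𝒜.FinitelyAmbiguous ∧ ∀ w, f w = 𝒜.output w}

/-- The class of polynomial-ambiguously recognisable functions. -/
def PAWA : Set (List A → S) :=
  {f | ∃ (Q : Type) (_ : Fintype Q) (𝒜 : WeightedAutomaton A S Q),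
    𝒜.PolynomiallyAmbiguous ∧ ∀ w, f w = 𝒜.output w}

end Classes

section Functions

variable {A : Type*} [DecidableEq A]

/-- For `w = a₁ ⋯ aₙ`, the number `|a₁ ⋯ aᵢ|_a + |aᵢ₊₁ ⋯ aₙ|_b`. -/
def cut (a b : A) (w : List A) (i : ℕ) : ℕ := (w.take i).count a + (w.drop i).count b

/-- The set of the lengths of the maximal (non-empty) blocks of `b`'s in `w`: the word is split at
all letters other than `b`, and empty pieces are dropped. -/
def blockLengths (b : A) (w : List A) : Finset ℕ :=
  (((w.splitOnP (fun c => c != b)).map List.length).toFinset).erase 0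

/-- `min {|w|_a, |w|_b}`. -/
def f₂ (a b : A) (w : List A) : ℕ∞ := ((min (w.count a) (w.count b) : ℕ) : ℕ∞)

/-- `min_{0 ≤ i ≤ n} (|a₁ ⋯ aᵢ|_a + |aᵢ₊₁ ⋯ aₙ|_b)`. -/
noncomputable def f₃ (a b : A) (w : List A) : ℕ∞ :=
  (Finset.range (w.length + 1)).inf (fun i => (cut a b w i : ℕ∞))

/-- The length of the shortest block of `b`'s (`+∞` if there is none). -/
noncomputable def f₄ (b : A) (w : List A) : ℕ∞ := (blockLengths b w).inf (fun n => (n : ℕ∞))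

/-- `∑ᵢ f₂(wᵢ)` where `w = w₀ h w₁ h ⋯ h wₙ` and `h` does not occur in the `wᵢ`. -/
def f₅ (a b h : A) (w : List A) : ℕ∞ := ((w.splitOn h).map (f₂ a b)).sum

/-- `∑ᵢ f₄(wᵢ)` where `w = w₀ h w₁ h ⋯ h wₙ` and `h` does not occur in the `wᵢ`. -/
noncomputable def f₆ (b h : A) (w : List A) : ℕ∞ := ((w.splitOn h).map (f₄ b)).sum

/-- `max {|w|_a, |w|_b}`. -/
def g₂ (a b : A) (w : List A) : WithBot ℕ := ((max (w.count a) (w.count b) : ℕ) : WithBot ℕ)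

/-- `max_{0 ≤ i ≤ n} (|a₁ ⋯ aᵢ|_a + |aᵢ₊₁ ⋯ aₙ|_b)`. -/
def g₃ (a b : A) (w : List A) : WithBot ℕ :=
  (Finset.range (w.length + 1)).sup (fun i => (cut a b w i : WithBot ℕ))

/-- The length of the longest block of `b`'s (`-∞` if there is none). -/
def g₄ (b : A) (w : List A) : WithBot ℕ := (blockLengths b w).sup (fun n => (n : WithBot ℕ))

/-- `∑ᵢ g₂(wᵢ)` where `w = w₀ h w₁ h ⋯ h wₙ` and `h` does not occur in the `wᵢ`. -/
def g₅ (a b h : A) (w : List A) : WithBot ℕ := ((w.splitOn h).map (g₂ a b)).sum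

/-- `∑ᵢ g₃(wᵢ)` where `w = w₀ h w₁ h ⋯ h wₙ` and `h` does not occur in the `wᵢ`. -/
def g₆ (a b h : A) (w : List A) : WithBot ℕ := ((w.splitOn h).map (g₃ a b)).sum

end Functions

/-- A function with values in `ℕ ∪ {+∞}` as a function to the min-plus semiring. -/
def toMin {A : Type*} (f : List A → ℕ∞) : List A → MinPlus := fun w => Tropical.trop (f w)

/-- A function with values in `ℕ ∪ {-∞}` as a function to the max-plus semiring. -/
def toMax {A : Type*} (g : List A → WithBot ℕ) : List A → MaxPlus := fun w => MaxPlus.mk (g w)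

end WeightedAut

open WeightedAut

/-! In both semirings addition is selective: `x + y` is `x` or `y`. So a nonzero output is the
weight of one accepting run that dominates all others, and every run has a cost in `ℕ`. The argument
is carried out for such semirings; min and max differ in the direction of one inequality.

Membership is by explicit automata: a copy per counted letter, one guess of a cut or of a block
(linearly many runs), and for sums over pieces a restart at each separator.

For non-membership, on words `α₁^e₁ u₁ ⋯ αₘ^eₘ uₘ` with positive exponents each function becomes the
minimum or maximum over `i` of `∑ j ∈ T i, e j`, where the sets `T i` are distinct and of equal size
`r`. An automaton computing this has at least as many accepting runs as there are sets, on the word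
with all exponents `n + P`, where `n = |Q| + 1` and `P` is a large multiple of `|Q|!`. Indeed every
block contains a loop whose length divides `|Q|!`, so it can be lengthened by `P` without changing
the end states.

Min (`card_le_ncard_acceptingRuns_of_min`): let the blocks in `T i` have length `n` and the others
`n + P`. An optimal run costs at most `r * n`. Lengthening any block of `T i` raises the output to
at least `r * n + P`, so that pumping costs at least `P`. Pumping all of `T i` gives a run on the
uniform word that is expensive exactly on `T i`, whence `T i` can be recovered.

Max (`card_le_ncard_acceptingRuns_of_max`): let the blocks in `T i` have length `n + P` and the
others `n`. Pumping the others leaves the output at `r * (n + P)`, so it cannot raise the cost; the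
run stays cheap off `T i` and costs `r * (n + P)` in total. A run serving two sets would be cheap
off their intersection, which has at most `r - 1` elements, and could not cost that much.

There are two sets for `f₂`, `g₂`, arbitrarily many for `f₃`, `f₄`, `g₃`, `g₄`, and for the sums
over pieces the `2 ^ (k + 1)` transversals of `k + 1` pairs of blocks, on words of length quadratic
in `k`. -/

namespace WeightedAut

/-! ### Semirings with selective addition and a valuation -/

/-- A commutative semiring with selective addition, a valuation in `ℕ` of its nonzero elements which
turns products into sums, and an element `gen` whose `n`-th power has valuation `n`. -/
class TropicalLike (S : Type*) [CommSemiring S] where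
  /-- the element of valuation one -/
  gen : S
  /-- the valuation of the nonzero elements -/
  val : S → ℕ
  add_selective : ∀ x y : S, x + y = x ∨ x + y = y
  mul_ne_zero : ∀ {x y : S}, x ≠ 0 → y ≠ 0 → x * y ≠ 0
  gen_pow_ne_zero : ∀ n, gen ^ n ≠ 0
  val_mul : ∀ {x y : S}, x ≠ 0 → y ≠ 0 → val (x * y) = val x + val y
  val_gen_pow : ∀ n, val (gen ^ n) = n

/-- Addition is the minimum of the valuations. -/
class IsMinLike (S : Type*) [CommSemiring S] [TropicalLike S] : Prop where
  val_le : ∀ {x y : S}, x ≠ 0 → y ≠ 0 → x + y = y → TropicalLike.val y ≤ TropicalLike.val x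
  one_add_gen_pow : ∀ n, (1 : S) + TropicalLike.gen ^ n = 1

/-- Addition is the maximum of the valuations. -/
class IsMaxLike (S : Type*) [CommSemiring S] [TropicalLike S] : Prop where
  val_le : ∀ {x y : S}, x ≠ 0 → y ≠ 0 → x + y = y → TropicalLike.val x ≤ TropicalLike.val y
  one_add_gen_pow : ∀ n, (1 : S) + TropicalLike.gen ^ n = TropicalLike.gen ^ n

namespace TropicalLike

theorem ne_zero_of_add_eq {S : Type*} [CommSemiring S] {x y : S} (hx : x ≠ 0) (h : x + y = y) :
    y ≠ 0 := by
  rintro rfl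
  exact hx (by simpa using h)

variable {S : Type*} [CommSemiring S] [TropicalLike S]

theorem add_self (x : S) : x + x = x := by
  rcases add_selective x x with h | h <;> exact h

theorem one_ne_zero : (1 : S) ≠ 0 := by
  simpa using gen_pow_ne_zero (S := S) 0

theorem val_one : val (1 : S) = 0 := by
  simpa using val_gen_pow (S := S) 0

/-- Idempotence lets the sum absorb each of its terms; this expresses domination of a term without
choosing an order. -/
theorem add_sum_of_mem {ι : Type*} {s : Finset ι} (f : ι → S) {i : ι} (hi : i ∈ s) :
    f i + ∑ j ∈ s, f j = ∑ j ∈ s, f j := by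
  classical
  rw [← Finset.add_sum_erase s f hi, ← add_assoc, add_self]

theorem exists_sum_eq {ι : Type*} {s : Finset ι} (f : ι → S) (h : ∑ j ∈ s, f j ≠ 0) :
    ∃ i ∈ s, ∑ j ∈ s, f j = f i := by
  classical
  induction s using Finset.induction_on with
  | empty => simp at h
  | insert a s ha ih =>
    rw [Finset.sum_insert ha] at h ⊢
    rcases add_selective (f a) (∑ j ∈ s, f j) with h' | h'
    · exact ⟨a, Finset.mem_insert_self _ _, h'⟩
    · rw [h'] at h ⊢
      obtain ⟨i, hi, e⟩ := ih h
      exact ⟨i, Finset.mem_insert_of_mem hi, e⟩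

theorem sum_gen_pow_ne_zero {ι : Type*} {s : Finset ι} (hs : s.Nonempty) (f : ι → ℕ) :
    ∑ i ∈ s, (gen : S) ^ f i ≠ 0 := by
  obtain ⟨i, hi⟩ := hs
  exact ne_zero_of_add_eq (gen_pow_ne_zero (f i)) (add_sum_of_mem (fun i => (gen : S) ^ f i) hi)

theorem exists_val_sum_gen_pow {ι : Type*} {s : Finset ι} (hs : s.Nonempty) (f : ι → ℕ) :
    ∃ i ∈ s, val (∑ i ∈ s, (gen : S) ^ f i) = f i := by
  obtain ⟨i, hi, e⟩ := exists_sum_eq _ (sum_gen_pow_ne_zero (S := S) hs f)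
  exact ⟨i, hi, by rw [e, val_gen_pow]⟩

end TropicalLike

theorem IsMinLike.val_sum_gen_pow_le {S : Type*} [CommSemiring S] [TropicalLike S] [IsMinLike S]
    {ι : Type*} {s : Finset ι} (f : ι → ℕ) {i : ι} (hi : i ∈ s) :
    TropicalLike.val (∑ i ∈ s, (TropicalLike.gen : S) ^ f i) ≤ f i := by
  have := IsMinLike.val_le (TropicalLike.gen_pow_ne_zero (S := S) (f i))
    (TropicalLike.sum_gen_pow_ne_zero ⟨i, hi⟩ f)
    (TropicalLike.add_sum_of_mem (fun i => (TropicalLike.gen : S) ^ f i) hi)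
  rwa [TropicalLike.val_gen_pow] at this

theorem IsMaxLike.le_val_sum_gen_pow {S : Type*} [CommSemiring S] [TropicalLike S] [IsMaxLike S]
    {ι : Type*} {s : Finset ι} (f : ι → ℕ) {i : ι} (hi : i ∈ s) :
    f i ≤ TropicalLike.val (∑ i ∈ s, (TropicalLike.gen : S) ^ f i) := by
  have := IsMaxLike.val_le (TropicalLike.gen_pow_ne_zero (S := S) (f i))
    (TropicalLike.sum_gen_pow_ne_zero ⟨i, hi⟩ f)
    (TropicalLike.add_sum_of_mem (fun i => (TropicalLike.gen : S) ^ f i) hi)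
  rwa [TropicalLike.val_gen_pow] at this

/-! ### The min-plus and max-plus semirings as instances -/

theorem MinPlus.exists_eq_coe {x : MinPlus} (hx : x ≠ 0) :
    ∃ n : ℕ, x = Tropical.trop (n : ℕ∞) := by
  have : Tropical.untrop x ≠ ⊤ := fun h => hx (Tropical.untrop_injective h)
  obtain ⟨n, hn⟩ := ENat.ne_top_iff_exists.mp this
  exact ⟨n, by rw [hn, Tropical.trop_untrop]⟩

theorem MinPlus.trop_one_pow (n : ℕ) :
    (Tropical.trop (1 : ℕ∞)) ^ n = Tropical.trop (n : ℕ∞) := by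
  rw [← Tropical.trop_nsmul]; simp

theorem MinPlus.trop_coe_ne_zero (n : ℕ) : (Tropical.trop (n : ℕ∞) : MinPlus) ≠ 0 := fun h =>
  ENat.natCast_ne_top n (congrArg Tropical.untrop h)

instance : TropicalLike MinPlus where
  gen := Tropical.trop 1
  val x := (Tropical.untrop x).toNat
  add_selective x y := by
    rcases le_total x y with h | h
    · exact Or.inl (Tropical.add_eq_left h)
    · exact Or.inr (Tropical.add_eq_right h)
  mul_ne_zero {x y} hx hy := by
    obtain ⟨m, rfl⟩ := MinPlus.exists_eq_coe hx
    obtain ⟨n, rfl⟩ := MinPlus.exists_eq_coe hy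
    rw [← Tropical.trop_add]
    exact_mod_cast MinPlus.trop_coe_ne_zero (m + n)
  gen_pow_ne_zero n := by rw [MinPlus.trop_one_pow]; exact MinPlus.trop_coe_ne_zero n
  val_mul {x y} hx hy := by
    obtain ⟨m, rfl⟩ := MinPlus.exists_eq_coe hx
    obtain ⟨n, rfl⟩ := MinPlus.exists_eq_coe hy
    rw [← Tropical.trop_add]
    simp only [Tropical.untrop_trop, ← Nat.cast_add, ENat.toNat_natCast]
  val_gen_pow n := by rw [MinPlus.trop_one_pow]; simp

instance : IsMinLike MinPlus where
  val_le {x y} hx hy h := by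
    obtain ⟨m, rfl⟩ := MinPlus.exists_eq_coe hx
    obtain ⟨n, rfl⟩ := MinPlus.exists_eq_coe hy
    rw [Tropical.add_eq_right_iff] at h
    have h2 : (n : ℕ∞) ≤ m := h
    simpa [TropicalLike.val] using h2
  one_add_gen_pow n := by
    change (1 : MinPlus) + Tropical.trop 1 ^ n = 1
    rw [MinPlus.trop_one_pow, Tropical.add_eq_left_iff]
    exact zero_le (a := (n : ℕ∞))

namespace MaxPlus

theorem exists_eq_coe {x : MaxPlus} (hx : x ≠ 0) : ∃ n : ℕ, x = mk (n : WithBot ℕ) := by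
  have : x.val ≠ ⊥ := fun h => hx (MaxPlus.ext h)
  obtain ⟨n, hn⟩ := WithBot.ne_bot_iff_exists.mp this
  exact ⟨n, MaxPlus.ext hn.symm⟩

theorem mk_coe_ne_zero (n : ℕ) : mk (n : WithBot ℕ) ≠ 0 := fun h =>
  WithBot.coe_ne_bot (congrArg val h)

theorem mk_add (x y : WithBot ℕ) : mk (x + y) = mk x * mk y := rfl

theorem mk_max (x y : WithBot ℕ) : mk (max x y) = mk x + mk y := rfl

theorem mk_one_pow (n : ℕ) : mk 1 ^ n = mk (n : WithBot ℕ) := by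
  induction n with
  | zero => rfl
  | succ n ih => rw [pow_succ, ih, ← mk_add]; push_cast; rfl

instance : TropicalLike MaxPlus where
  gen := mk 1
  val x := x.val.unbotD 0
  add_selective x y := by
    rcases le_total x.val y.val with h | h
    · exact Or.inr (MaxPlus.ext (max_eq_right h))
    · exact Or.inl (MaxPlus.ext (max_eq_left h))
  mul_ne_zero {x y} hx hy := by
    obtain ⟨m, rfl⟩ := exists_eq_coe hx
    obtain ⟨n, rfl⟩ := exists_eq_coe hy
    exact mk_coe_ne_zero (m + n)
  gen_pow_ne_zero n := by rw [mk_one_pow]; exact mk_coe_ne_zero n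
  val_mul {x y} hx hy := by
    obtain ⟨m, rfl⟩ := exists_eq_coe hx
    obtain ⟨n, rfl⟩ := exists_eq_coe hy
    rfl
  val_gen_pow n := by rw [mk_one_pow]; rfl

instance : IsMaxLike MaxPlus where
  val_le {x y} hx hy h := by
    obtain ⟨m, rfl⟩ := exists_eq_coe hx
    obtain ⟨n, rfl⟩ := exists_eq_coe hy
    have : max (m : WithBot ℕ) n = n := congrArg val h
    have h2 : (m : WithBot ℕ) ≤ n := by rw [← this]; exact le_max_left _ _
    exact Nat.cast_le.mp h2
  one_add_gen_pow n := by
    change (1 : MaxPlus) + mk 1 ^ n = mk 1 ^ n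
    rw [mk_one_pow]
    apply MaxPlus.ext
    change max (0 : WithBot ℕ) n = n
    exact max_eq_right (by positivity)

end MaxPlus

/-! ### Paths and their weights -/

namespace WeightedAutomaton

variable {A S Q : Type*} [CommSemiring S]

/-- The list `τ` of transitions is a path from `p` to `q`. -/
def IsPath (𝒜 : WeightedAutomaton A S Q) : Q → List (Q × A × Q) → Q → Prop
  | p, [], q => p = q
  | p, t :: τ, q => t.1 = p ∧ 𝒜.M t.2.1 t.1 t.2.2 ≠ 0 ∧ 𝒜.IsPath t.2.2 τ q

/-- The label of a list of transitions. -/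
def label (τ : List (Q × A × Q)) : List A := τ.map fun t => t.2.1

/-- The product of the weights of a list of transitions. -/
def pathWeight (𝒜 : WeightedAutomaton A S Q) (τ : List (Q × A × Q)) : S :=
  (τ.map fun t => 𝒜.M t.2.1 t.1 t.2.2).prod

/-- The sum of the valuations of the weights of a list of transitions. -/
def cost [TropicalLike S] (𝒜 : WeightedAutomaton A S Q) (τ : List (Q × A × Q)) : ℕ :=
  (τ.map fun t => TropicalLike.val (𝒜.M t.2.1 t.1 t.2.2)).sum

/-- `τ` is an accepting path from `p` to `q` with label `w`. -/
structure Accepts (𝒜 : WeightedAutomaton A S Q) (w : List A) (p : Q) (τ : List (Q × A × Q))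
    (q : Q) : Prop where
  initial : 𝒜.I p ≠ 0
  isPath : 𝒜.IsPath p τ q
  label_eq : label τ = w
  final : 𝒜.F q ≠ 0

/-- The vector `M_{a₁} ⬝ ⋯ ⬝ M_{aₙ} ⬝ F`. -/
def future [Fintype Q] (𝒜 : WeightedAutomaton A S Q) (w : List A) : Q → S :=
  w.foldr (fun c x => 𝒜.M c *ᵥ x) 𝒜.F

section Paths

variable {𝒜 : WeightedAutomaton A S Q}

theorem label_append (τ τ' : List (Q × A × Q)) : label (τ ++ τ') = label τ ++ label τ' :=
  List.map_append

theorem length_label (τ : List (Q × A × Q)) : (label τ).length = τ.length := List.length_map _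

theorem cost_append [TropicalLike S] (τ τ' : List (Q × A × Q)) :
    𝒜.cost (τ ++ τ') = 𝒜.cost τ + 𝒜.cost τ' := by
  simp [cost]

theorem isPath_append {p q : Q} {τ τ' : List (Q × A × Q)} :
    𝒜.IsPath p (τ ++ τ') q ↔ ∃ r, 𝒜.IsPath p τ r ∧ 𝒜.IsPath r τ' q := by
  induction τ generalizing p with
  | nil => simp [IsPath]
  | cons t τ ih => simp only [List.cons_append, IsPath, ih]; grind

theorem IsPath.append {p q r : Q} {τ τ' : List (Q × A × Q)} (h : 𝒜.IsPath p τ q)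
    (h' : 𝒜.IsPath q τ' r) : 𝒜.IsPath p (τ ++ τ') r :=
  isPath_append.mpr ⟨q, h, h'⟩

theorem IsPath.target_unique {p q r : Q} {τ : List (Q × A × Q)} (h : 𝒜.IsPath p τ q)
    (h' : 𝒜.IsPath p τ r) : q = r := by
  induction τ generalizing p with
  | nil => exact h.symm.trans h'
  | cons t τ ih => exact ih h.2.2 h'.2.2

theorem IsPath.pathWeight_ne_zero [TropicalLike S] {p q : Q} {τ : List (Q × A × Q)}
    (h : 𝒜.IsPath p τ q) : 𝒜.pathWeight τ ≠ 0 := by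
  induction τ generalizing p with
  | nil => exact TropicalLike.one_ne_zero
  | cons t τ ih =>
    simp only [pathWeight, List.map_cons, List.prod_cons]
    exact TropicalLike.mul_ne_zero h.2.1 (ih h.2.2)

theorem IsPath.val_pathWeight [TropicalLike S] {p q : Q} {τ : List (Q × A × Q)}
    (h : 𝒜.IsPath p τ q) : TropicalLike.val (𝒜.pathWeight τ) = 𝒜.cost τ := by
  induction τ generalizing p with
  | nil => exact TropicalLike.val_one
  | cons t τ ih =>
    have h2 := h.2.2.pathWeight_ne_zero
    have h3 := ih h.2.2
    simp only [pathWeight, cost, List.map_cons, List.prod_cons, List.sum_cons] at h2 h3 ⊢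
    rw [TropicalLike.val_mul h.2.1 h2, h3]

end Paths

section Accepting

variable [TropicalLike S] {𝒜 : WeightedAutomaton A S Q}

/-- The valuation of the weight of an accepting path from `p` to `q`. -/
def totalCost (𝒜 : WeightedAutomaton A S Q) (p : Q) (τ : List (Q × A × Q)) (q : Q) : ℕ :=
  TropicalLike.val (𝒜.I p) + (𝒜.cost τ + TropicalLike.val (𝒜.F q))

theorem Accepts.weight_ne_zero {w : List A} {p q : Q} {τ : List (Q × A × Q)}
    (h : 𝒜.Accepts w p τ q) : 𝒜.I p * (𝒜.pathWeight τ * 𝒜.F q) ≠ 0 :=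
  TropicalLike.mul_ne_zero h.initial
    (TropicalLike.mul_ne_zero h.isPath.pathWeight_ne_zero h.final)

theorem Accepts.val_weight {w : List A} {p q : Q} {τ : List (Q × A × Q)}
    (h : 𝒜.Accepts w p τ q) :
    TropicalLike.val (𝒜.I p * (𝒜.pathWeight τ * 𝒜.F q)) = 𝒜.totalCost p τ q := by
  rw [TropicalLike.val_mul h.initial
    (TropicalLike.mul_ne_zero h.isPath.pathWeight_ne_zero h.final),
    TropicalLike.val_mul h.isPath.pathWeight_ne_zero h.final, h.isPath.val_pathWeight]
  rfl

end Accepting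

/-! ### The output as the weight of a dominating accepting path -/

section Output

variable [Fintype Q] {𝒜 : WeightedAutomaton A S Q}

theorem future_cons (c : A) (w : List A) : 𝒜.future (c :: w) = 𝒜.M c *ᵥ 𝒜.future w := rfl

theorem output_eq_dotProduct_future (𝒜 : WeightedAutomaton A S Q) (w : List A) :
    𝒜.output w = 𝒜.I ⬝ᵥ 𝒜.future w := by
  have key : ∀ x : Q → S, w.foldl (fun x c => x ᵥ* 𝒜.M c) x ⬝ᵥ 𝒜.F = x ⬝ᵥ 𝒜.future w := by
    induction w with
    | nil => intro x; rfl
    | cons c w ih => intro x; rw [List.foldl_cons, ih, future_cons, Matrix.dotProduct_mulVec]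
  exact key _

variable [TropicalLike S]

theorem IsPath.add_future {p q : Q} {τ : List (Q × A × Q)} (h : 𝒜.IsPath p τ q) :
    𝒜.pathWeight τ * 𝒜.F q + 𝒜.future (label τ) p = 𝒜.future (label τ) p := by
  induction τ generalizing p with
  | nil =>
    obtain rfl : p = q := h
    simp [pathWeight, label, future, TropicalLike.add_self]
  | cons t τ ih =>
    obtain ⟨rfl, -, h⟩ := h
    have e := TropicalLike.add_sum_of_mem
      (fun r => 𝒜.M t.2.1 t.1 r * 𝒜.future (label τ) r) (Finset.mem_univ t.2.2)
    change 𝒜.pathWeight (t :: τ) * 𝒜.F q + ∑ r, 𝒜.M t.2.1 t.1 r * 𝒜.future (label τ) r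
      = ∑ r, 𝒜.M t.2.1 t.1 r * 𝒜.future (label τ) r
    rw [← e, ← add_assoc]
    congr 1
    rw [show 𝒜.pathWeight (t :: τ) = 𝒜.M t.2.1 t.1 t.2.2 * 𝒜.pathWeight τ from List.prod_cons,
      mul_assoc, ← mul_add, ih h]

theorem exists_isPath_of_future_ne_zero {w : List A} {p : Q} (h : 𝒜.future w p ≠ 0) :
    ∃ τ q, 𝒜.IsPath p τ q ∧ label τ = w ∧ 𝒜.F q ≠ 0 ∧
      𝒜.future w p = 𝒜.pathWeight τ * 𝒜.F q := by
  induction w generalizing p with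
  | nil => exact ⟨[], p, rfl, rfl, h, (one_mul _).symm⟩
  | cons c w ih =>
    obtain ⟨r, -, e⟩ := TropicalLike.exists_sum_eq (fun r => 𝒜.M c p r * 𝒜.future w r) h
    change 𝒜.future (c :: w) p = 𝒜.M c p r * 𝒜.future w r at e
    have h1 : 𝒜.M c p r ≠ 0 := fun h0 => h (by rw [e, h0, zero_mul])
    have h2 : 𝒜.future w r ≠ 0 := fun h0 => h (by rw [e, h0, mul_zero])
    obtain ⟨τ, q, hτ, hl, hq, e'⟩ := ih h2
    refine ⟨(p, c, r) :: τ, q, ⟨rfl, h1, hτ⟩, congrArg (c :: ·) hl, hq, ?_⟩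
    rw [e, e', show 𝒜.pathWeight ((p, c, r) :: τ) = 𝒜.M c p r * 𝒜.pathWeight τ from
      List.prod_cons, mul_assoc]

theorem Accepts.add_output {w : List A} {p q : Q} {τ : List (Q × A × Q)}
    (h : 𝒜.Accepts w p τ q) :
    𝒜.I p * (𝒜.pathWeight τ * 𝒜.F q) + 𝒜.output w = 𝒜.output w := by
  have e := TropicalLike.add_sum_of_mem (fun r => 𝒜.I r * 𝒜.future w r) (Finset.mem_univ p)
  rw [output_eq_dotProduct_future]
  change _ + ∑ r, 𝒜.I r * 𝒜.future w r = ∑ r, 𝒜.I r * 𝒜.future w r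
  rw [← e, ← add_assoc]
  congr 1
  rw [← mul_add, ← h.label_eq, h.isPath.add_future]

theorem Accepts.output_ne_zero {w : List A} {p q : Q} {τ : List (Q × A × Q)}
    (h : 𝒜.Accepts w p τ q) : 𝒜.output w ≠ 0 :=
  TropicalLike.ne_zero_of_add_eq h.weight_ne_zero h.add_output

/-- By selectivity the sum over successor states equals one of its terms at every letter, so the
matrix product collapses to the weight of a single path. -/
theorem exists_accepts {w : List A} (h : 𝒜.output w ≠ 0) :
    ∃ p τ q, 𝒜.Accepts w p τ q ∧ TropicalLike.val (𝒜.output w) = 𝒜.totalCost p τ q := by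
  rw [output_eq_dotProduct_future] at h
  obtain ⟨p, -, e⟩ := TropicalLike.exists_sum_eq (fun r => 𝒜.I r * 𝒜.future w r) h
  change 𝒜.I ⬝ᵥ 𝒜.future w = 𝒜.I p * 𝒜.future w p at e
  have h1 : 𝒜.I p ≠ 0 := fun h0 => h (by rw [e, h0, zero_mul])
  have h2 : 𝒜.future w p ≠ 0 := fun h0 => h (by rw [e, h0, mul_zero])
  obtain ⟨τ, q, hτ, hl, hq, e'⟩ := exists_isPath_of_future_ne_zero h2
  have hacc : 𝒜.Accepts w p τ q := ⟨h1, hτ, hl, hq⟩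
  exact ⟨p, τ, q, hacc, by rw [output_eq_dotProduct_future, e, e', hacc.val_weight]⟩

theorem Accepts.val_output_le [IsMinLike S] {w : List A} {p q : Q} {τ : List (Q × A × Q)}
    (h : 𝒜.Accepts w p τ q) : TropicalLike.val (𝒜.output w) ≤ 𝒜.totalCost p τ q := by
  rw [← h.val_weight]
  exact IsMinLike.val_le h.weight_ne_zero h.output_ne_zero h.add_output

theorem Accepts.le_val_output [IsMaxLike S] {w : List A} {p q : Q} {τ : List (Q × A × Q)}
    (h : 𝒜.Accepts w p τ q) : 𝒜.totalCost p τ q ≤ TropicalLike.val (𝒜.output w) := by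
  rw [← h.val_weight]
  exact IsMaxLike.val_le h.weight_ne_zero h.output_ne_zero h.add_output

end Output

/-! ### Paths versus accepting runs -/

section Runs

variable {𝒜 : WeightedAutomaton A S Q}

/-- The state reached from `p` after `i` transitions of `τ`. -/
def stateAt (p : Q) : List (Q × A × Q) → ℕ → Q
  | [], _ => p
  | _ :: _, 0 => p
  | t :: τ, i + 1 => stateAt t.2.2 τ i

theorem stateAt_zero (p : Q) (τ : List (Q × A × Q)) : stateAt p τ 0 = p := by
  cases τ <;> rfl

theorem IsPath.stateAt_length {p q : Q} {τ : List (Q × A × Q)} (h : 𝒜.IsPath p τ q) :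
    stateAt p τ τ.length = q := by
  induction τ generalizing p with
  | nil => exact h
  | cons t τ ih => exact ih h.2.2

theorem IsPath.step_ne_zero {p q : Q} {τ : List (Q × A × Q)} (h : 𝒜.IsPath p τ q) {i : ℕ}
    (hi : i < (label τ).length) :
    𝒜.M ((label τ)[i]) (stateAt p τ i) (stateAt p τ (i + 1)) ≠ 0 := by
  induction τ generalizing p i with
  | nil => simp [label] at hi
  | cons t τ ih =>
    obtain ⟨rfl, h1, h2⟩ := h
    cases i with
    | zero => simpa [label, stateAt, stateAt_zero] using h1
    | succ i => exact ih h2 (by simpa [label] using hi)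

theorem IsPath.eq_of_stateAt_eq {p q p' q' : Q} {τ τ' : List (Q × A × Q)} (h : 𝒜.IsPath p τ q)
    (h' : 𝒜.IsPath p' τ' q') (hl : label τ = label τ')
    (hs : ∀ i ≤ τ.length, stateAt p τ i = stateAt p' τ' i) : p = p' ∧ τ = τ' := by
  induction τ generalizing p p' τ' with
  | nil =>
    obtain rfl : τ' = [] := List.map_eq_nil_iff.mp hl.symm
    exact ⟨hs 0 le_rfl, rfl⟩
  | cons t τ ih =>
    cases τ' with
    | nil => simp [label] at hl
    | cons t' τ' =>
      obtain ⟨rfl, -, h⟩ := h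
      obtain ⟨rfl, -, h'⟩ := h'
      have hl' := List.cons.inj hl
      have h0 : t.1 = t'.1 := hs 0 (Nat.zero_le _)
      obtain ⟨e1, e2⟩ := ih h h' hl'.2
        (fun i hi => hs (i + 1) (by simpa using hi))
      refine ⟨h0, ?_⟩
      rw [e2, Prod.ext h0 (Prod.ext hl'.1 e1)]

theorem Accepts.mem_acceptingRuns {w : List A} {p q : Q} {τ : List (Q × A × Q)}
    (h : 𝒜.Accepts w p τ q) :
    (fun i : Fin (w.length + 1) => stateAt p τ i) ∈ 𝒜.acceptingRuns w := by
  obtain ⟨h1, h2, rfl, h3⟩ := h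
  refine ⟨by simpa [stateAt_zero] using h1, fun i => h2.step_ne_zero i.2, ?_⟩
  rw [← h2.stateAt_length] at h3
  simpa [length_label] using h3

/-- Paths with a common label are determined by their state sequences, so distinct paths are
distinct runs. Finiteness of `Q` makes the set of runs finite; `ncard` would otherwise be `0`. -/
theorem card_le_ncard_acceptingRuns [Finite Q] {ι : Type*} [Fintype ι] {w : List A} (p q : ι → Q)
    (τ : ι → List (Q × A × Q)) (h : ∀ i, 𝒜.Accepts w (p i) (τ i) (q i))
    (hinj : ∀ i j, p i = p j → τ i = τ j → i = j) :
    Fintype.card ι ≤ (𝒜.acceptingRuns w).ncard := by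
  let g : ι → (Fin (w.length + 1) → Q) := fun i k => stateAt (p i) (τ i) k
  have hg : Function.Injective g := by
    intro i j e
    obtain ⟨e1, e2⟩ := (h i).isPath.eq_of_stateAt_eq (h j).isPath
      ((h i).label_eq.trans (h j).label_eq.symm) (fun k hk => by
        have hk' : k < w.length + 1 := by
          rw [← (h i).label_eq, length_label]; omega
        exact congrFun e ⟨k, hk'⟩)
    exact hinj i j e1 e2
  calc Fintype.card ι = (Set.range g).ncard := by
        rw [← Set.image_univ, Set.ncard_image_of_injective _ hg, Set.ncard_univ,
          Nat.card_eq_fintype_card]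
    _ ≤ _ := Set.ncard_le_ncard (by rintro _ ⟨i, rfl⟩; exact (h i).mem_acceptingRuns)
        (Set.toFinite _)

end Runs

/-! ### Loops and pumping -/

section Pumping

variable {𝒜 : WeightedAutomaton A S Q}

theorem IsPath.take {p q : Q} {τ : List (Q × A × Q)} (h : 𝒜.IsPath p τ q) {i : ℕ}
    (hi : i ≤ τ.length) : 𝒜.IsPath p (τ.take i) (stateAt p τ i) := by
  induction τ generalizing p i with
  | nil => simp [IsPath, stateAt]
  | cons t τ ih =>
    cases i with
    | zero => rfl
    | succ i => exact ⟨h.1, h.2.1, ih h.2.2 (by simpa using hi)⟩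

theorem IsPath.of_append {p q r : Q} {τ τ' : List (Q × A × Q)} (h : 𝒜.IsPath p (τ ++ τ') q)
    (h' : 𝒜.IsPath p τ r) : 𝒜.IsPath r τ' q := by
  obtain ⟨r', h1, h2⟩ := isPath_append.mp h
  rwa [h1.target_unique h'] at h2

theorem IsPath.flatten_replicate {r : Q} {σ : List (Q × A × Q)} (h : 𝒜.IsPath r σ r) (m : ℕ) :
    𝒜.IsPath r (List.replicate m σ).flatten r := by
  induction m with
  | zero => rfl
  | succ m ih => exact h.append ih

/-- Pigeonhole on the first `|Q| + 1` states only, which keeps the loop length at most `|Q|`. -/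
theorem IsPath.exists_loop [Fintype Q] {p q : Q} {τ : List (Q × A × Q)} (h : 𝒜.IsPath p τ q)
    (hn : Fintype.card Q ≤ τ.length) :
    ∃ (r : Q) (τ₁ σ τ₂ : List (Q × A × Q)), τ = τ₁ ++ (σ ++ τ₂) ∧ 𝒜.IsPath p τ₁ r ∧
      𝒜.IsPath r σ r ∧ 𝒜.IsPath r τ₂ q ∧ 0 < σ.length ∧ σ.length ≤ Fintype.card Q := by
  obtain ⟨i, j, hij, e⟩ : ∃ i j : Fin (Fintype.card Q + 1), i < j ∧
      stateAt p τ i = stateAt p τ j := by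
    obtain ⟨i, j, hne, e⟩ := Fintype.exists_ne_map_eq_of_card_lt
      (fun i : Fin (Fintype.card Q + 1) => stateAt p τ i) (by simp)
    rcases lt_or_gt_of_ne hne with h | h
    · exact ⟨i, j, h, e⟩
    · exact ⟨j, i, h, e.symm⟩
  have hij' : (i : ℕ) < j := hij
  have hj : (j : ℕ) ≤ Fintype.card Q := Nat.lt_succ_iff.mp j.2
  have h1 := h.take (i := i) (by omega)
  have h2 := h.take (i := j) (by omega)
  have e1 : τ.take j = τ.take i ++ (τ.take j).drop i := by
    conv_lhs => rw [← List.take_append_drop i (τ.take j)]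
    rw [List.take_take, min_eq_left hij'.le]
  have e2 : τ = τ.take i ++ ((τ.take j).drop i ++ τ.drop j) := by
    rw [← List.append_assoc, ← e1, List.take_append_drop]
  refine ⟨stateAt p τ i, τ.take i, (τ.take j).drop i, τ.drop j, e2, h1, ?_, ?_, ?_, ?_⟩
  · rw [e1, ← e] at h2
    exact h2.of_append h1
  · rw [e]
    rw [← List.take_append_drop j τ] at h
    exact h.of_append h2
  all_goals
    simp only [List.length_drop, List.length_take]
    omega

theorem mem_label_of_mem_flatten_replicate {σ : List (Q × A × Q)} {m : ℕ} {c : A}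
    (h : c ∈ label (List.replicate m σ).flatten) : c ∈ label σ := by
  simp only [label, List.mem_map, List.mem_flatten, List.mem_replicate] at h ⊢
  obtain ⟨t, ⟨l, ⟨-, rfl⟩, ht⟩, e⟩ := h
  exact ⟨t, ht, e⟩

variable [TropicalLike S]

/-- The loop length divides `|Q|!`, so the same extension works for every block, whatever loop it
contains. Costs are natural numbers, so extra loops never lower the cost. -/
theorem IsPath.exists_pump [Fintype Q] {p q : Q} {τ : List (Q × A × Q)} {c : A} {n : ℕ}
    (h : 𝒜.IsPath p τ q) (hl : label τ = List.replicate n c) (hn : Fintype.card Q ≤ n) (s : ℕ) :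
    ∃ τ', 𝒜.IsPath p τ' q ∧ label τ' = List.replicate (n + s * (Fintype.card Q).factorial) c ∧
      𝒜.cost τ ≤ 𝒜.cost τ' := by
  have hlen : τ.length = n := by rw [← length_label, hl, List.length_replicate]
  obtain ⟨r, τ₁, σ, τ₂, rfl, h1, h2, h3, hpos, hle⟩ := h.exists_loop (hlen ▸ hn)
  obtain ⟨d, hd⟩ := (Nat.dvd_factorial hpos hle)
  refine ⟨τ₁ ++ ((List.replicate (s * d) σ).flatten ++ (σ ++ τ₂)),
    h1.append ((h2.flatten_replicate _).append (h2.append h3)), ?_, ?_⟩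
  · rw [List.eq_replicate_iff] at hl ⊢
    refine ⟨?_, fun c' hc' => hl.2 c' ?_⟩
    · simp only [length_label, List.length_append, List.length_flatten, List.map_replicate,
        List.sum_replicate, smul_eq_mul] at hlen ⊢
      rw [hd, ← hlen]
      ring
    · simp only [label_append, List.mem_append] at hc' ⊢
      rcases hc' with h | h | h
      · exact Or.inl h
      · exact Or.inr (Or.inl (mem_label_of_mem_flatten_replicate h))
      · exact Or.inr h
  · simp only [cost_append]
    omega

theorem IsPath.exists_pump_append [Fintype Q] {p q : Q} {τ : List (Q × A × Q)} {c : A} {n : ℕ}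
    {u : List A} (h : 𝒜.IsPath p τ q) (hl : label τ = List.replicate n c ++ u)
    (hn : Fintype.card Q ≤ n) (s : ℕ) :
    ∃ τ', 𝒜.IsPath p τ' q ∧
      label τ' = List.replicate (n + s * (Fintype.card Q).factorial) c ++ u ∧
      𝒜.cost τ ≤ 𝒜.cost τ' := by
  obtain ⟨τ₁, τ₂, rfl, e1, e2⟩ := List.map_eq_append_iff.mp hl
  obtain ⟨r, h1, h2⟩ := isPath_append.mp h
  obtain ⟨τ', h3, h4, h5⟩ := h1.exists_pump e1 hn s
  refine ⟨τ' ++ τ₂, h3.append h2, ?_, ?_⟩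
  · rw [label_append, h4]
    exact congrArg _ e2
  · simp only [cost_append]
    omega

/-! ### Pumping the blocks of a word independently, and counting the resulting runs -/

section Blocks

variable {J : Type*}

/-- The concatenation over `j` in `js` of the words `α(j) ^ e(j) ⬝ u(j)`. -/
def blockWord (js : List J) (α : J → A) (u : J → List A) (e : J → ℕ) : List A :=
  js.flatMap fun j => List.replicate (e j) (α j) ++ u j

omit [TropicalLike S] in
theorem IsPath.exists_decomposition [DecidableEq J] {js : List J} (hjs : js.Nodup)
    {v : J → List A} {p q : Q} {τ : List (Q × A × Q)} (h : 𝒜.IsPath p τ q)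
    (hl : label τ = js.flatMap v) :
    ∃ (x y : J → Q) (σ : J → List (Q × A × Q)), τ = js.flatMap σ ∧
      (∀ j ∈ js, 𝒜.IsPath (x j) (σ j) (y j) ∧ label (σ j) = v j) ∧
      ∀ σ' : J → List (Q × A × Q), (∀ j ∈ js, 𝒜.IsPath (x j) (σ' j) (y j)) →
        𝒜.IsPath p (js.flatMap σ') q := by
  induction js generalizing p τ with
  | nil =>
    obtain rfl : τ = [] := List.map_eq_nil_iff.mp hl
    exact ⟨fun _ => p, fun _ => p, fun _ => [], rfl, by simp, fun _ _ => h⟩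
  | cons i js ih =>
    rw [List.flatMap_cons] at hl
    obtain ⟨τ₁, τ₂, rfl, e1, e2⟩ := List.map_eq_append_iff.mp hl
    obtain ⟨r, h1, h2⟩ := isPath_append.mp h
    have hi := (List.nodup_cons.mp hjs).1
    obtain ⟨x, y, σ, rfl, h3, h4⟩ := ih (List.nodup_cons.mp hjs).2 h2 e2
    have hne : ∀ j ∈ js, j ≠ i := fun j hj hji => hi (hji ▸ hj)
    refine ⟨Function.update x i p, Function.update y i r, Function.update σ i τ₁, ?_, ?_, ?_⟩
    · rw [List.flatMap_cons, Function.update_self]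
      congr 1
      exact List.flatMap_congr fun j hj => by rw [Function.update_of_ne (hne j hj)]
    · intro j hj
      rcases List.mem_cons.mp hj with rfl | hj
      · simpa using ⟨h1, e1⟩
      · simpa [Function.update_of_ne (hne j hj)] using h3 j hj
    · intro σ' hσ'
      rw [List.flatMap_cons]
      refine IsPath.append (q := r) (by simpa using hσ' i List.mem_cons_self)
        (h4 σ' fun j hj => ?_)
      simpa [Function.update_of_ne (hne j hj)] using hσ' j (List.mem_cons_of_mem _ hj)

theorem cost_flatMap [Fintype J] {js : List J} (hnd : js.Nodup) (hjs : ∀ j, j ∈ js)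
    (σ : J → List (Q × A × Q)) : 𝒜.cost (js.flatMap σ) = ∑ j, 𝒜.cost (σ j) := by
  classical
  have h1 : 𝒜.cost (js.flatMap σ) = (js.map fun j => 𝒜.cost (σ j)).sum := by
    clear hnd hjs
    induction js with
    | nil => rfl
    | cons j js ih => rw [List.flatMap_cons, cost_append, ih, List.map_cons, List.sum_cons]
  have h2 : js.toFinset = Finset.univ := by ext j; simp [hjs]
  rw [h1, ← List.sum_toFinset _ hnd, h2]

-- The labels fix the lengths of the pieces, so the concatenation can be cut in only one way.
omit [CommSemiring S] [TropicalLike S] in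
theorem eq_of_flatMap_eq {js : List J} {σ σ' : J → List (Q × A × Q)}
    (hl : ∀ j, label (σ j) = label (σ' j)) (h : js.flatMap σ = js.flatMap σ') :
    ∀ j ∈ js, σ j = σ' j := by
  induction js with
  | nil => simp
  | cons i js ih =>
    rw [List.flatMap_cons, List.flatMap_cons] at h
    have hlen : (σ i).length = (σ' i).length := by rw [← length_label, hl, length_label]
    obtain ⟨h1, h2⟩ := List.append_inj h hlen
    intro j hj
    rcases List.mem_cons.mp hj with rfl | hj
    · exact h1
    · exact ih h2 j hj

/-- The pumped pieces are chosen once, before `D`: the cost of pumping a block can be measured with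
one choice of `D` and used with another. -/
theorem Accepts.exists_pumpable [Fintype Q] [DecidableEq J] {js : List J} (hnd : js.Nodup)
    (hjs : ∀ j, j ∈ js) {α : J → A} {u : J → List A} {e : J → ℕ} {p q : Q}
    {τ : List (Q × A × Q)} (h : 𝒜.Accepts (blockWord js α u e) p τ q)
    (he : ∀ j, Fintype.card Q ≤ e j) (s : ℕ) :
    ∃ σ σ' : J → List (Q × A × Q), τ = js.flatMap σ ∧ (∀ j, 𝒜.cost (σ j) ≤ 𝒜.cost (σ' j)) ∧
      (∀ j, label (σ j) = List.replicate (e j) (α j) ++ u j) ∧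
      (∀ j, label (σ' j) =
        List.replicate (e j + s * (Fintype.card Q).factorial) (α j) ++ u j) ∧
      ∀ D : Finset J, 𝒜.Accepts
        (blockWord js α u fun j => if j ∈ D then e j + s * (Fintype.card Q).factorial else e j)
        p (js.flatMap fun j => if j ∈ D then σ' j else σ j) q := by
  obtain ⟨x, y, σ, hτ, h1, h2⟩ := h.isPath.exists_decomposition hnd h.label_eq
  have h3 : ∀ j, ∃ τ', 𝒜.IsPath (x j) τ' (y j) ∧
      label τ' = List.replicate (e j + s * (Fintype.card Q).factorial) (α j) ++ u j ∧
      𝒜.cost (σ j) ≤ 𝒜.cost τ' := fun j =>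
    (h1 j (hjs j)).1.exists_pump_append (h1 j (hjs j)).2 (he j) s
  choose σ' h4 h5 h6 using h3
  refine ⟨σ, σ', hτ, h6, fun j => (h1 j (hjs j)).2, h5, fun D => ⟨h.initial, ?_, ?_, h.final⟩⟩
  · refine h2 _ fun j hj => ?_
    split_ifs
    · exact h4 j
    · exact (h1 j hj).1
  · rw [label, List.map_flatMap, blockWord]
    refine List.flatMap_congr fun j hj => ?_
    split_ifs
    · exact h5 j
    · exact (h1 j hj).2

theorem totalCost_flatMap [Fintype J] {js : List J} (hnd : js.Nodup) (hjs : ∀ j, j ∈ js)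
    (σ : J → List (Q × A × Q)) (p q : Q) :
    𝒜.totalCost p (js.flatMap σ) q =
      TropicalLike.val (𝒜.I p) + (∑ j, 𝒜.cost (σ j) + TropicalLike.val (𝒜.F q)) := by
  rw [totalCost, cost_flatMap hnd hjs]

theorem eq_of_subset_of_card {ι : Type*} {T : ι → Finset J} {r : ℕ} (hcard : ∀ i, (T i).card = r)
    (hinj : Function.Injective T) {i l : ι} (h : T i ⊆ T l) : i = l :=
  hinj (Finset.eq_of_subset_of_card_le h (by rw [hcard, hcard]))

variable [Fintype J] [DecidableEq J] [Fintype Q] {ι : Type*} [Fintype ι]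

/-- The run built for `i` costs at least `P` on each block of `T i` and at most `r * n < P` on every
other block, so it determines `T i`. -/
theorem card_le_ncard_acceptingRuns_of_min [IsMinLike S] {js : List J} (hnd : js.Nodup)
    (hjs : ∀ j, j ∈ js) {α : J → A} {u : J → List A} {T : ι → Finset J} {r : ℕ}
    (hcard : ∀ i, (T i).card = r) (hinj : Function.Injective T)
    (hval : ∀ e : J → ℕ, (∀ j, 0 < e j) →
      𝒜.output (blockWord js α u e) = ∑ i, (TropicalLike.gen : S) ^ ∑ j ∈ T i, e j)
    {s : ℕ} (hs : r * (Fintype.card Q + 1) < s * (Fintype.card Q).factorial) :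
    Fintype.card ι ≤ (𝒜.acceptingRuns (blockWord js α u fun _ =>
      Fintype.card Q + 1 + s * (Fintype.card Q).factorial)).ncard := by
  set n := Fintype.card Q + 1 with hn
  set P := s * (Fintype.card Q).factorial with hP
  have key : ∀ i, ∃ (p q : Q) (ξ : J → List (Q × A × Q)),
      𝒜.Accepts (blockWord js α u fun _ => n + P) p (js.flatMap ξ) q ∧
      (∀ j, label (ξ j) = List.replicate (n + P) (α j) ++ u j) ∧
      (∀ j ∉ T i, 𝒜.cost (ξ j) ≤ r * n) ∧ ∀ j ∈ T i, P ≤ 𝒜.cost (ξ j) := by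
    intro i
    -- `T i` is the cheap choice here. The summand `1` in `n` keeps the exponents positive even when
    -- `Q` is empty.
    let e : J → ℕ := fun j => if j ∈ T i then n else n + P
    have hne : (Finset.univ : Finset ι).Nonempty := ⟨i, Finset.mem_univ _⟩
    have he : ∀ j, n ≤ e j := fun j => by simp only [e]; split_ifs <;> omega
    have hv := hval e (fun j => by have := he j; omega)
    obtain ⟨p, τ, q, hacc, hc⟩ := exists_accepts (𝒜 := 𝒜) (w := blockWord js α u e)
      (by rw [hv]; exact TropicalLike.sum_gen_pow_ne_zero hne _)
    have hle : 𝒜.totalCost p τ q ≤ r * n := by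
      rw [← hc, hv]
      refine (IsMinLike.val_sum_gen_pow_le _ (Finset.mem_univ i)).trans ?_
      rw [Finset.sum_congr rfl (fun j hj => if_pos hj : ∀ j ∈ T i, e j = n), Finset.sum_const,
        hcard, smul_eq_mul]
    obtain ⟨σ, σ', rfl, h1, h2, h3, h4⟩ := hacc.exists_pumpable hnd hjs
      (fun j => by have := he j; omega) s
    rw [totalCost_flatMap hnd hjs] at hle
    refine ⟨p, q, fun j => if j ∈ T i then σ' j else σ j, ?_, ?_, ?_, ?_⟩
    · convert h4 (T i) using 2
      ext j
      simp only [e]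
      split_ifs <;> rfl
    · intro j
      by_cases hj : j ∈ T i
      · simp only [if_pos hj, h3, e]
        rfl
      · simp only [if_neg hj, h2, e]
    · intro j hj
      have := Finset.single_le_sum (f := fun j => 𝒜.cost (σ j)) (fun _ _ => Nat.zero_le _)
        (Finset.mem_univ j)
      simp only [if_neg hj]
      omega
    · intro d hd
      simp only [if_pos hd]
      -- Pumping the single block `d` reveals how much the pumped piece there must cost.
      have h5 := h4 {d}
      have h6 := h5.val_output_le
      rw [hval _ (fun j => by have := he j; split_ifs <;> omega)] at h6
      obtain ⟨l, -, hl⟩ := TropicalLike.exists_val_sum_gen_pow (S := S) hne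
        (fun i => ∑ j ∈ T i, if j ∈ ({d} : Finset J) then e j + P else e j)
      rw [hl, totalCost_flatMap hnd hjs] at h6
      -- Every `T l` contains a block of length at least `n + P`: the block `d` if `T l = T i`,
      -- otherwise a block outside `T i`. Its other `r - 1` blocks have length at least `n`.
      have h7 : r * n + P ≤ ∑ j ∈ T l, if j ∈ ({d} : Finset J) then e j + P else e j := by
        obtain ⟨j₀, hj₀, hj₁⟩ : ∃ j ∈ T l,
            n + P ≤ if j ∈ ({d} : Finset J) then e j + P else e j := by
          by_cases hli : T l ⊆ T i
          · obtain rfl := eq_of_subset_of_card hcard hinj hli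
            exact ⟨d, hd, by have := he d; simp; omega⟩
          · obtain ⟨j, hj, hj'⟩ := Finset.not_subset.mp hli
            exact ⟨j, hj, by simp only [e, if_neg hj']; split_ifs <;> omega⟩
        rw [← Finset.add_sum_erase _ _ hj₀]
        have h8 : (r - 1) * n ≤
            ∑ j ∈ (T l).erase j₀, if j ∈ ({d} : Finset J) then e j + P else e j := by
          rw [← hcard l, ← Finset.card_erase_of_mem hj₀, ← smul_eq_mul]
          refine Finset.card_nsmul_le_sum _ _ _ fun j _ => ?_
          have := he j
          split_ifs <;> omega
        have h9 : r - 1 + 1 = r := Nat.sub_add_cancel (by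
          rw [← hcard l]; exact Finset.card_pos.mpr ⟨j₀, hj₀⟩)
        have h10 : r * n = (r - 1) * n + n := by rw [← Nat.succ_mul, Nat.succ_eq_add_one, h9]
        omega
      -- The two paths differ only at `d`, so the increase of the total, at least `P`, is paid
      -- there.
      have h11 : ∑ j, 𝒜.cost (if j ∈ ({d} : Finset J) then σ' j else σ j) + 𝒜.cost (σ d) =
          ∑ j, 𝒜.cost (σ j) + 𝒜.cost (σ' d) := by
        rw [← Finset.add_sum_erase _ _ (Finset.mem_univ d),
          ← Finset.add_sum_erase Finset.univ (fun j => 𝒜.cost (σ j)) (Finset.mem_univ d),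
          Finset.sum_congr rfl (fun j hj => by
            rw [if_neg (by simpa using Finset.ne_of_mem_erase hj)] :
            ∀ j ∈ Finset.univ.erase d, 𝒜.cost (if j ∈ ({d} : Finset J) then σ' j else σ j)
              = 𝒜.cost (σ j))]
        simp only [Finset.mem_singleton, if_true]
        omega
      omega
  choose p q ξ h1 h2 h3 h4 using key
  refine card_le_ncard_acceptingRuns p q (fun i => js.flatMap (ξ i)) h1 fun i l _ heq => ?_
  have hξ := eq_of_flatMap_eq (fun j => (h2 i j).trans (h2 l j).symm) heq
  refine eq_of_subset_of_card hcard hinj fun j hj => ?_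
  by_contra hj'
  have h5 := h3 l j hj'
  have h6 := h4 i j hj
  rw [hξ j (hjs j)] at h6
  omega

/-- The number `C` bounds the excess of the cost of a part of an accepting path over its length, and
the initial and final costs. -/
structure CostBound (𝒜 : WeightedAutomaton A S Q) (C : ℕ) : Prop where
  cost_le : ∀ {w : List A} {p q : Q} {τ₁ τ₂ τ₃ : List (Q × A × Q)},
    𝒜.Accepts w p (τ₁ ++ (τ₂ ++ τ₃)) q → 𝒜.cost τ₂ ≤ τ₂.length + C
  val_add_val_le : ∀ p q : Q, TropicalLike.val (𝒜.I p) + TropicalLike.val (𝒜.F q) ≤ C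

-- A segment of an accepting path can be completed to an accepting path by a prefix and a suffix
-- depending only on its end states. The output on the completed label is at most its length, so the
-- segment's cost exceeds its length by at most the completions' lengths; summing over all states
-- makes the bound uniform.
omit [Fintype J] [DecidableEq J] [Fintype ι] in
theorem exists_costBound [IsMaxLike S]
    (hlen : ∀ w, 𝒜.output w ≠ 0 → TropicalLike.val (𝒜.output w) ≤ w.length) :
    ∃ C, 𝒜.CostBound C := by
  have h1 : ∀ x, ∃ m, (∃ p τ, 𝒜.I p ≠ 0 ∧ 𝒜.IsPath p τ x) →
      ∃ p τ, 𝒜.I p ≠ 0 ∧ 𝒜.IsPath p τ x ∧ τ.length = m := fun x => by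
    by_cases h : ∃ p τ, 𝒜.I p ≠ 0 ∧ 𝒜.IsPath p τ x
    · obtain ⟨p, τ, h1, h2⟩ := h
      exact ⟨τ.length, fun _ => ⟨p, τ, h1, h2, rfl⟩⟩
    · exact ⟨0, fun h' => (h h').elim⟩
  have h2 : ∀ x, ∃ m, (∃ τ q, 𝒜.IsPath x τ q ∧ 𝒜.F q ≠ 0) →
      ∃ τ q, 𝒜.IsPath x τ q ∧ 𝒜.F q ≠ 0 ∧ τ.length = m := fun x => by
    by_cases h : ∃ τ q, 𝒜.IsPath x τ q ∧ 𝒜.F q ≠ 0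
    · obtain ⟨τ, q, h1, h2⟩ := h
      exact ⟨τ.length, fun _ => ⟨τ, q, h1, h2, rfl⟩⟩
    · exact ⟨0, fun h' => (h h').elim⟩
  choose f hf using h1
  choose g hg using h2
  have hle : ∀ (a : Q → ℕ) (x : Q), a x ≤ ∑ y, a y := fun a x =>
    Finset.single_le_sum (fun _ _ => Nat.zero_le _) (Finset.mem_univ x)
  refine ⟨(∑ x, f x + ∑ x, g x) + (∑ x, TropicalLike.val (𝒜.I x) + ∑ x, TropicalLike.val (𝒜.F x)),
    ?_, fun p q => ?_⟩
  · intro w p q τ₁ τ₂ τ₃ h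
    obtain ⟨x, hx, h'⟩ := isPath_append.mp h.isPath
    obtain ⟨y, hxy, hy⟩ := isPath_append.mp h'
    obtain ⟨p', ρ, k1, k2, k3⟩ := hf x ⟨p, τ₁, h.initial, hx⟩
    obtain ⟨ρ', q', k4, k5, k6⟩ := hg y ⟨τ₃, q, hy, h.final⟩
    have hacc : 𝒜.Accepts (label (ρ ++ (τ₂ ++ ρ'))) p' (ρ ++ (τ₂ ++ ρ')) q' :=
      ⟨k1, k2.append (hxy.append k4), rfl, k5⟩
    have k7 := hacc.le_val_output.trans (hlen _ hacc.output_ne_zero)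
    simp only [length_label, List.length_append, totalCost, cost_append] at k7
    have k8 := hle f x
    have k9 := hle g y
    omega
  · have k8 := hle (fun x => TropicalLike.val (𝒜.I x)) p
    have k9 := hle (fun x => TropicalLike.val (𝒜.F x)) q
    omega

omit [Fintype Q] [Fintype J] [DecidableEq J] in
theorem CostBound.cost_le_of_mem {C : ℕ} (hC : 𝒜.CostBound C) {w : List A} {p q : Q}
    {js : List J} {σ : J → List (Q × A × Q)} (h : 𝒜.Accepts w p (js.flatMap σ) q) {j : J}
    (hj : j ∈ js) : 𝒜.cost (σ j) ≤ (σ j).length + C := by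
  obtain ⟨l₁, l₂, rfl⟩ := List.append_of_mem hj
  rw [List.flatMap_append, List.flatMap_cons] at h
  exact hC.cost_le h

/-- The total cost `r * (n + P)` has to be earned on the blocks of `T i`, since each other block
costs at most `n + |u j| + C`. The bound on `s` makes `P` exceed all these small contributions
together. -/
theorem card_le_ncard_acceptingRuns_of_max [IsMaxLike S] {C : ℕ} (hC : 𝒜.CostBound C)
    {js : List J} (hnd : js.Nodup)
    (hjs : ∀ j, j ∈ js) {α : J → A} {u : J → List A} {T : ι → Finset J} {r : ℕ}
    (hcard : ∀ i, (T i).card = r) (hinj : Function.Injective T)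
    (hval : ∀ e : J → ℕ, (∀ j, 0 < e j) →
      𝒜.output (blockWord js α u e) = ∑ i, (TropicalLike.gen : S) ^ ∑ j ∈ T i, e j)
    {s : ℕ} (hs : C + ∑ j, (Fintype.card Q + 1 + (u j).length + C) <
      s * (Fintype.card Q).factorial) :
    Fintype.card ι ≤ (𝒜.acceptingRuns (blockWord js α u fun _ =>
      Fintype.card Q + 1 + s * (Fintype.card Q).factorial)).ncard := by
  set n := Fintype.card Q + 1 with hn
  set P := s * (Fintype.card Q).factorial with hP
  have key : ∀ i, ∃ (p q : Q) (ξ : J → List (Q × A × Q)),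
      𝒜.Accepts (blockWord js α u fun _ => n + P) p (js.flatMap ξ) q ∧
      (∀ j, label (ξ j) = List.replicate (n + P) (α j) ++ u j) ∧
      (∀ j ∉ T i, 𝒜.cost (ξ j) ≤ n + (u j).length + C) ∧
      r * (n + P) ≤ 𝒜.totalCost p (js.flatMap ξ) q := by
    intro i
    let e : J → ℕ := fun j => if j ∈ T i then n + P else n
    have hne : (Finset.univ : Finset ι).Nonempty := ⟨i, Finset.mem_univ _⟩
    have he : ∀ j, n ≤ e j := fun j => by simp only [e]; split_ifs <;> omega
    have hv := hval e (fun j => by have := he j; omega)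
    obtain ⟨p, τ, q, hacc, hc⟩ := exists_accepts (𝒜 := 𝒜) (w := blockWord js α u e)
      (by rw [hv]; exact TropicalLike.sum_gen_pow_ne_zero hne _)
    have hle : r * (n + P) ≤ 𝒜.totalCost p τ q := by
      rw [← hc, hv]
      refine le_trans ?_ (IsMaxLike.le_val_sum_gen_pow _ (Finset.mem_univ i))
      rw [Finset.sum_congr rfl (fun j hj => if_pos hj : ∀ j ∈ T i, e j = n + P),
        Finset.sum_const, hcard, smul_eq_mul]
    obtain ⟨σ, σ', rfl, h1, h2, h3, h4⟩ := hacc.exists_pumpable hnd hjs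
      (fun j => by have := he j; omega) s
    let ξ : J → List (Q × A × Q) := fun j => if j ∈ (T i)ᶜ then σ' j else σ j
    have hξ : 𝒜.Accepts (blockWord js α u fun _ => n + P) p (js.flatMap ξ) q := by
      convert h4 (T i)ᶜ using 2
      ext j
      simp only [e, Finset.mem_compl]
      split_ifs <;> rfl
    -- On the uniform word every `T l` gives the same value.
    have hup : 𝒜.totalCost p (js.flatMap ξ) q ≤ r * (n + P) := by
      refine hξ.le_val_output.trans ?_
      rw [hval _ (fun j => by omega)]
      obtain ⟨l, -, hl⟩ := TropicalLike.exists_val_sum_gen_pow (S := S) hne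
        (fun i => ∑ j ∈ T i, (n + P))
      rw [hl, Finset.sum_const, hcard, smul_eq_mul]
    have hmono : ∀ j, 𝒜.cost (σ j) ≤ 𝒜.cost (ξ j) := fun j => by
      simp only [ξ]
      split_ifs
      exacts [h1 j, le_rfl]
    have hsum : ∑ j, 𝒜.cost (σ j) ≤ ∑ j, 𝒜.cost (ξ j) := Finset.sum_le_sum fun j _ => hmono j
    rw [totalCost_flatMap hnd hjs] at hle hup
    refine ⟨p, q, ξ, hξ, ?_, ?_, ?_⟩
    · intro j
      by_cases hj : j ∈ T i
      · simp only [ξ, Finset.mem_compl, hj, not_true_eq_false, if_false, h2, e, if_true]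
      · simp only [ξ, Finset.mem_compl, hj, not_false_eq_true, if_true, h3, e, if_false]
        rfl
    · intro j hj
      -- The totals before and after pumping are squeezed together, so no block became more
      -- expensive.
      have h5 : ∀ j, 𝒜.cost (ξ j) ≤ 𝒜.cost (σ j) := fun j => by
        by_contra hlt
        have := Finset.sum_lt_sum (fun j _ => hmono j) ⟨j, Finset.mem_univ j, not_le.mp hlt⟩
        omega
      refine (h5 j).trans ((hC.cost_le_of_mem hacc (hjs j)).trans ?_)
      rw [← length_label, h2]
      simp [e, hj]
    · rw [totalCost_flatMap hnd hjs]
      omega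
  choose p q ξ h1 h2 h3 h4 using key
  refine card_le_ncard_acceptingRuns p q (fun i => js.flatMap (ξ i)) h1 fun i l _ heq => ?_
  have hξ := eq_of_flatMap_eq (fun j => (h2 i j).trans (h2 l j).symm) heq
  by_contra hil
  have h5 : (T i ∩ T l).card + 1 ≤ r := by
    rw [← hcard i]
    refine Finset.card_lt_card (Finset.ssubset_iff_subset_ne.mpr ⟨Finset.inter_subset_left, ?_⟩)
    exact fun h => hil (eq_of_subset_of_card hcard hinj (Finset.inter_eq_left.mp h))
  -- If the runs of `i` and `l` coincide, a block missing from either set is cheap.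
  have h6 : ∀ j, 𝒜.cost (ξ i j) ≤ (n + (u j).length + C) + if j ∈ T i ∩ T l then P else 0 := by
    intro j
    by_cases hi : j ∈ T i
    · by_cases hl : j ∈ T l
      · have := hC.cost_le_of_mem (h1 i) (hjs j)
        rw [← length_label, h2] at this
        simp only [List.length_append, List.length_replicate] at this
        simp only [Finset.mem_inter, hi, hl, and_self, if_true]
        omega
      · have := h3 l j hl
        rw [hξ j (hjs j)]
        omega
    · have := h3 i j hi
      omega
  have h7 := Finset.sum_le_sum fun j (_ : j ∈ Finset.univ) => h6 j
  rw [Finset.sum_add_distrib, ← Finset.sum_filter, Finset.sum_const, smul_eq_mul,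
    Finset.filter_mem_eq_inter, Finset.univ_inter] at h7
  have h8 := h4 i
  rw [totalCost_flatMap hnd hjs] at h8
  have h9 := hC.val_add_val_le (p i) (q i)
  have h10 : ((T i ∩ T l).card + 1) * P ≤ r * P := Nat.mul_le_mul_right _ h5
  rw [Nat.add_mul, one_mul] at h10
  rw [Nat.mul_add] at h8
  omega

end Blocks

end Pumping

end WeightedAutomaton

open TropicalLike

/-! ### The witness functions as expressions in the semiring -/

section GenericFunctions

variable {A : Type*} [DecidableEq A] {S : Type*} [CommSemiring S] [TropicalLike S]

variable (S) in
/-- The weight of the letter `c` in an automaton that counts the letter `a`. -/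
def letterWeight (a c : A) : S := if c = a then gen else 1

variable (S) in
/-- The common form of `f₂` and `g₂`. -/
def countSum (a b : A) (w : List A) : S := gen ^ w.count a + gen ^ w.count b

variable (S) in
/-- The common form of `f₃` and `g₃`. -/
def cutSum (a b : A) (w : List A) : S := ∑ i ∈ Finset.range (w.length + 1), gen ^ cut a b w i

variable (S) in
/-- The common form of `f₄` and `g₄`. -/
def blockSum (b : A) (w : List A) : S := ∑ n ∈ blockLengths b w, gen ^ n

/-- The product of the values of `f` on the pieces of `w` between the letters `h`. -/
def splitProd (h : A) (f : List A → S) (w : List A) : S := ((w.splitOn h).map f).prod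

variable (S) in
/-- The contribution of a piece of length `n` to `blockSum`. -/
def blockTerm (n : ℕ) : S := if n = 0 then 0 else gen ^ n

theorem toMin_f₂ (a b : A) : toMin (f₂ a b) = countSum MinPlus a b := by
  funext w
  simp only [countSum, gen, MinPlus.trop_one_pow, toMin, f₂]
  rw [← Tropical.trop_min, Nat.mono_cast.map_min]

theorem toMin_f₃ (a b : A) : toMin (f₃ a b) = cutSum MinPlus a b := by
  funext w
  simp only [cutSum, gen, MinPlus.trop_one_pow, toMin, f₃, Finset.trop_inf]

theorem toMin_f₄ (b : A) : toMin (f₄ b) = blockSum MinPlus b := by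
  funext w
  simp only [blockSum, gen, MinPlus.trop_one_pow, toMin, f₄, Finset.trop_inf]

theorem toMin_f₅ (a b h : A) : toMin (f₅ a b h) = splitProd h (countSum MinPlus a b) := by
  funext w
  simp only [toMin, f₅, splitProd, List.trop_sum, List.map_map, ← toMin_f₂]
  rfl

theorem toMin_f₆ (b h : A) : toMin (f₆ b h) = splitProd h (blockSum MinPlus b) := by
  funext w
  simp only [toMin, f₆, splitProd, List.trop_sum, List.map_map, ← toMin_f₄]
  rfl

theorem MaxPlus.mk_finset_sup {ι : Type*} (s : Finset ι) (f : ι → WithBot ℕ) :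
    MaxPlus.mk (s.sup f) = ∑ i ∈ s, MaxPlus.mk (f i) := by
  classical
  induction s using Finset.induction_on with
  | empty => rfl
  | insert a s ha ih => rw [Finset.sum_insert ha, Finset.sup_insert, ← ih]; rfl

theorem MaxPlus.mk_list_sum (l : List (WithBot ℕ)) :
    MaxPlus.mk l.sum = (l.map MaxPlus.mk).prod := by
  induction l with
  | nil => rfl
  | cons x l ih => rw [List.sum_cons, List.map_cons, List.prod_cons, ← ih]; rfl

theorem toMax_g₂ (a b : A) : toMax (g₂ a b) = countSum MaxPlus a b := by
  funext w
  simp only [countSum, gen, MaxPlus.mk_one_pow, toMax, g₂]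
  rw [← MaxPlus.mk_max, Nat.mono_cast.map_max]

theorem toMax_g₃ (a b : A) : toMax (g₃ a b) = cutSum MaxPlus a b := by
  funext w
  simp only [cutSum, gen, MaxPlus.mk_one_pow, toMax, g₃, MaxPlus.mk_finset_sup]

theorem toMax_g₄ (b : A) : toMax (g₄ b) = blockSum MaxPlus b := by
  funext w
  simp only [blockSum, gen, MaxPlus.mk_one_pow, toMax, g₄, MaxPlus.mk_finset_sup]

theorem toMax_g₅ (a b h : A) : toMax (g₅ a b h) = splitProd h (countSum MaxPlus a b) := by
  funext w
  simp only [toMax, g₅, splitProd, MaxPlus.mk_list_sum, List.map_map, ← toMax_g₂]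
  rfl

theorem toMax_g₆ (a b h : A) : toMax (g₆ a b h) = splitProd h (cutSum MaxPlus a b) := by
  funext w
  simp only [toMax, g₆, splitProd, MaxPlus.mk_list_sum, List.map_map, ← toMax_g₃]
  rfl

theorem gen_pow_count_cons (a c : A) (w : List A) :
    (gen : S) ^ (c :: w).count a = letterWeight S a c * gen ^ w.count a := by
  by_cases h : c = a
  · subst h; simp [letterWeight, pow_succ']
  · simp [letterWeight, h]

theorem cutSum_nil (a b : A) : cutSum S a b [] = 1 := by simp [cutSum, cut]

theorem cutSum_cons (a b c : A) (w : List A) :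
    cutSum S a b (c :: w) =
      letterWeight S a c * cutSum S a b w + gen ^ (c :: w).count b := by
  rw [cutSum, List.length_cons, Finset.sum_range_succ', cutSum, Finset.mul_sum]
  congr 1
  · refine Finset.sum_congr rfl fun i _ => ?_
    simp only [cut, List.take_succ_cons, List.drop_succ_cons, pow_add, gen_pow_count_cons,
      mul_assoc]
  · simp [cut]

/-- Repeated lengths are absorbed by idempotence, and empty pieces contribute zero, so the set of
block lengths may be replaced by the list. -/
theorem sum_toFinset_erase_zero (l : List ℕ) :
    ∑ n ∈ l.toFinset.erase 0, (gen : S) ^ n = (l.map (blockTerm S)).sum := by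
  induction l with
  | nil => rfl
  | cons n l ih =>
    rw [List.map_cons, List.sum_cons, ← ih, List.toFinset_cons, blockTerm]
    split_ifs with h
    · rw [h, Finset.erase_insert_eq_erase, zero_add]
    · rw [Finset.erase_insert_of_ne h]
      by_cases hn : n ∈ l.toFinset.erase 0
      · rw [Finset.insert_eq_of_mem hn, add_sum_of_mem (fun n => (gen : S) ^ n) hn]
      · rw [Finset.sum_insert hn]

theorem blockSum_eq (b : A) (w : List A) : blockSum S b w =
    ((w.splitOnP fun c => c != b).map fun u => blockTerm S u.length).sum := by
  rw [blockSum, blockLengths, sum_toFinset_erase_zero, List.map_map]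
  rfl

end GenericFunctions

/-! ### Automata for the witness functions and their ambiguity -/

namespace WeightedAutomaton

variable {A : Type*} [DecidableEq A] {S : Type*} [CommSemiring S] [TropicalLike S]

variable (S) in
/-- The automaton that counts either `a` or `b`. -/
def countAutomaton (a b : A) : WeightedAutomaton A S Bool where
  M c := Matrix.of fun p q => if p = q then letterWeight S (cond p a b) c else 0
  I _ := 1
  F _ := 1

variable (S) in
/-- The automaton that counts `a` and switches once to counting `b`. -/
def cutAutomaton (a b : A) : WeightedAutomaton A S Bool where
  M c := Matrix.of fun p q => match p, q with
    | false, false => letterWeight S a c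
    | false, true => letterWeight S b c
    | true, true => letterWeight S b c
    | true, false => 0
  I p := if p then 0 else 1
  F _ := 1

variable (S) in
/-- The automaton that chooses a block of `b`'s and outputs its length. The first component of a
state tells whether the block has been entered; the second one tells, before this, whether the last
letter was `b`, and afterwards, whether the block is still being read. -/
def blockAutomaton (b : A) : WeightedAutomaton A S (Bool × Bool) where
  M c := Matrix.of fun p q => match p, q with
    | (false, _), (false, x) => if decide (c = b) = x then 1 else 0
    | (false, false), (true, true) => if c = b then gen else 0
    | (true, true), (true, true) => if c = b then gen else 0
    | (true, true), (true, false) => if c = b then 0 else 1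
    | (true, false), (true, false) => 1
    | _, _ => 0
  I p := if p = (false, false) then 1 else 0
  F p := if p.1 then 1 else 0

omit [TropicalLike S] in
/-- The automaton that restarts `𝒜` at every letter `h`. -/
def restart {Q : Type*} (h : A) (𝒜 : WeightedAutomaton A S Q) : WeightedAutomaton A S Q where
  M c := if c = h then Matrix.of fun p q => 𝒜.F p * 𝒜.I q else 𝒜.M c
  I := 𝒜.I
  F := 𝒜.F

theorem output_countAutomaton (a b : A) (w : List A) :
    (countAutomaton S a b).output w = countSum S a b w := by
  have key : ∀ p, (countAutomaton S a b).future w p = gen ^ w.count (cond p a b) := by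
    induction w with
    | nil => intro p; simp [future, countAutomaton]
    | cons c w ih =>
      intro p
      rw [future_cons, gen_pow_count_cons, ← ih p]
      cases p <;> simp [Matrix.mulVec, dotProduct, countAutomaton]
  rw [output_eq_dotProduct_future, countSum]
  change ∑ p, (1 : S) * _ = _
  simp [key]

theorem output_cutAutomaton (a b : A) (w : List A) :
    (cutAutomaton S a b).output w = cutSum S a b w := by
  have key : (cutAutomaton S a b).future w true = gen ^ w.count b ∧
      (cutAutomaton S a b).future w false = cutSum S a b w := by
    induction w with
    | nil => simp [future, cutAutomaton, cutSum_nil]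
    | cons c w ih =>
      rw [future_cons, cutSum_cons, gen_pow_count_cons, ← ih.1, ← ih.2]
      constructor <;> simp [Matrix.mulVec, dotProduct, cutAutomaton, add_comm]
  rw [output_eq_dotProduct_future, ← key.2]
  simp [dotProduct, cutAutomaton]

theorem output_blockAutomaton (b : A) (w : List A) :
    (blockAutomaton S b).output w = blockSum S b w := by
  -- Here `u` is the piece at the start of the remaining word. After a `b` that was passed over, `u`
  -- is not a whole block and may not be chosen, so only `r` counts.
  have key : ∃ u r, w.splitOnP (fun c => c != b) = u :: r ∧
      (blockAutomaton S b).future w (true, false) = 1 ∧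
      (blockAutomaton S b).future w (true, true) = gen ^ u.length ∧
      (blockAutomaton S b).future w (false, true) =
        (r.map fun u => blockTerm S u.length).sum ∧
      (blockAutomaton S b).future w (false, false) =
        blockTerm S u.length + (r.map fun u => blockTerm S u.length).sum := by
    induction w with
    | nil => exact ⟨[], [], rfl, by simp [future, blockAutomaton, blockTerm]⟩
    | cons c w ih =>
      obtain ⟨u, r, e, h1, h2, h3, h4⟩ := ih
      rw [List.splitOnP_cons_eq_if_modifyHead, e, future_cons]
      generalize (blockAutomaton S b).future w = φ at h1 h2 h3 h4
      by_cases hc : c = b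
      · refine ⟨c :: u, r, by simp [hc], ?_⟩
        simp [Matrix.mulVec, dotProduct, Fintype.sum_prod_type, blockAutomaton, hc, blockTerm,
          pow_succ', h1, h2, h3, add_comm]
      · refine ⟨[], u :: r, by simp [hc], ?_⟩
        simp [Matrix.mulVec, dotProduct, Fintype.sum_prod_type, blockAutomaton, hc, blockTerm,
          h1, h4]
  obtain ⟨u, r, e, -, -, -, h⟩ := key
  rw [blockSum_eq, e, List.map_cons, List.sum_cons, ← h, output_eq_dotProduct_future]
  simp [dotProduct, blockAutomaton]

-- The matrix of `h` has rank one, namely `F` times the transpose of `I`, so the product factors at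
-- each `h`.
omit [TropicalLike S] in
theorem output_restart {Q : Type*} [Fintype Q] (h : A) (𝒜 : WeightedAutomaton A S Q) (w : List A) :
    (𝒜.restart h).output w = splitProd h 𝒜.output w := by
  have key : ∃ u r, w.splitOn h = u :: r ∧
      ∀ p, (𝒜.restart h).future w p = 𝒜.future u p * (r.map 𝒜.output).prod := by
    induction w with
    | nil => exact ⟨[], [], rfl, fun p => (mul_one _).symm⟩
    | cons c w ih =>
      obtain ⟨u, r, e, ih⟩ := ih
      rw [List.splitOn_cons_eq_if_modifyHead, e, future_cons]
      by_cases hc : c = h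
      · refine ⟨[], u :: r, by simp [hc], fun p => ?_⟩
        simp only [Matrix.mulVec, dotProduct, ih, List.map_cons, List.prod_cons,
          output_eq_dotProduct_future, Finset.sum_mul, Finset.mul_sum]
        simp only [restart, hc, if_true, Matrix.of_apply]
        exact Finset.sum_congr rfl fun q _ => by simp only [future, List.foldr_nil]; ring
      · refine ⟨c :: u, r, by simp [hc], fun p => ?_⟩
        rw [future_cons]
        simp only [Matrix.mulVec, dotProduct, ih, Finset.sum_mul]
        simp only [restart, hc, if_false, mul_assoc]
  obtain ⟨u, r, e, key⟩ := key
  rw [splitProd, e, output_eq_dotProduct_future, List.map_cons, List.prod_cons,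
    output_eq_dotProduct_future]
  simp only [dotProduct, key, Finset.sum_mul, mul_assoc]
  rfl

omit [DecidableEq A] [TropicalLike S] in
theorem ncard_acceptingRuns_le_of_diagonal {Q : Type*} [Fintype Q] (𝒜 : WeightedAutomaton A S Q)
    (hM : ∀ c p q, 𝒜.M c p q ≠ 0 → p = q) (w : List A) :
    (𝒜.acceptingRuns w).ncard ≤ Fintype.card Q := by
  have hc : ∀ ρ ∈ 𝒜.acceptingRuns w, ∀ i, ρ i = ρ 0 := fun ρ hρ i => by
    induction i using Fin.induction with
    | zero => rfl
    | succ i ih => rw [← ih, hM _ _ _ (hρ.2.1 i)]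
  have h := Set.ncard_le_ncard_of_injOn (t := Set.univ) (fun ρ : Fin (w.length + 1) → Q => ρ 0)
    (fun _ _ => Set.mem_univ _)
    (fun ρ hρ ρ' hρ' (e : ρ 0 = ρ' 0) => by
      funext i
      rw [hc ρ hρ, hc ρ' hρ', e] : Set.InjOn _ (𝒜.acceptingRuns w))
    (Set.toFinite _)
  rwa [Set.ncard_univ, Nat.card_eq_fintype_card] at h

theorem mem_iff_lt_card_of_isLowerSet {N : ℕ} {s : Finset (Fin N)}
    (hs : ∀ i j, i ≤ j → j ∈ s → i ∈ s) (i : Fin N) : i ∈ s ↔ (i : ℕ) < s.card := by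
  constructor
  · intro hi
    have h : Finset.Iic i ⊆ s := fun j hj => hs j i (Finset.mem_Iic.mp hj) hi
    have := Finset.card_le_card h
    rw [Fin.card_Iic] at this
    omega
  · intro hi
    by_contra hn
    have h : s ⊆ Finset.Iio i := fun j hj => Finset.mem_Iio.mpr (by
      by_contra hij
      exact hn (hs i j (not_lt.mp hij) hj))
    have := Finset.card_le_card h
    rw [Fin.card_Iio] at this
    omega

omit [DecidableEq A] [TropicalLike S] in
/-- An automaton which is deterministic up to the time at which it enters the second one of two
phases has at most linearly many runs. -/
theorem ncard_acceptingRuns_le_of_phase {Q : Type*} [Finite Q] (𝒜 : WeightedAutomaton A S Q)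
    (D : Q → Bool) (hI : ∀ p q, 𝒜.I p ≠ 0 → 𝒜.I q ≠ 0 → D p = D q → p = q)
    (hM : ∀ c p q q', 𝒜.M c p q ≠ 0 → 𝒜.M c p q' ≠ 0 → D q = D q' → q = q')
    (hD : ∀ c p q, 𝒜.M c p q ≠ 0 → D p = true → D q = true) (w : List A) :
    (𝒜.acceptingRuns w).ncard ≤ w.length + 2 := by
  have hmono : ∀ ρ ∈ 𝒜.acceptingRuns w, Monotone fun i => D (ρ i) := fun ρ hρ =>
    Fin.monotone_iff_le_succ.mpr fun i => Bool.le_iff_imp.mpr (hD _ _ _ (hρ.2.1 i))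
  -- The number of states in the first phase is the switching time. It has `w.length + 2` possible
  -- values and determines the run.
  let N : (Fin (w.length + 1) → Q) → ℕ := fun ρ => {i | D (ρ i) = false}.toFinset.card
  have hN : ∀ ρ ∈ 𝒜.acceptingRuns w, ∀ i, D (ρ i) = false ↔ (i : ℕ) < N ρ := fun ρ hρ i => by
    rw [← mem_iff_lt_card_of_isLowerSet, Set.mem_toFinset, Set.mem_ofPred_eq]
    intro i j hij hj
    simp only [Set.mem_toFinset, Set.mem_ofPred_eq] at hj ⊢
    have := hmono ρ hρ hij
    simp only [hj] at this
    exact Bool.eq_false_of_le_false this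
  have h := Set.ncard_le_ncard_of_injOn (t := (Finset.range (w.length + 2) : Set ℕ)) N
    (fun ρ _ => by
      have := Finset.card_le_univ {i | D (ρ i) = false}.toFinset
      rw [Fintype.card_fin] at this
      simp only [Finset.coe_range, Set.mem_Iio, N]
      omega)
    (fun ρ hρ ρ' hρ' (e : N ρ = N ρ') => by
      have hDD : ∀ i, D (ρ i) = D (ρ' i) := fun i => by
        have h1 := hN ρ hρ i
        rw [e, ← hN ρ' hρ' i] at h1
        cases h2 : D (ρ i) <;> cases h3 : D (ρ' i) <;> simp_all
      funext i
      induction i using Fin.induction with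
      | zero => exact hI _ _ hρ.1 hρ'.1 (hDD 0)
      | succ i ih =>
        have h1 := hρ.2.1 i
        rw [ih] at h1
        exact hM _ _ _ _ h1 (hρ'.2.1 i) (hDD _) : Set.InjOn N (𝒜.acceptingRuns w))
    (Set.toFinite _)
  rwa [Set.ncard_coe_finset, Finset.card_range] at h

omit [DecidableEq A] [TropicalLike S] in
theorem polynomiallyAmbiguous_of_phase {Q : Type*} [Finite Q] (𝒜 : WeightedAutomaton A S Q)
    (D : Q → Bool) (hI : ∀ p q, 𝒜.I p ≠ 0 → 𝒜.I q ≠ 0 → D p = D q → p = q)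
    (hM : ∀ c p q q', 𝒜.M c p q ≠ 0 → 𝒜.M c p q' ≠ 0 → D q = D q' → q = q')
    (hD : ∀ c p q, 𝒜.M c p q ≠ 0 → D p = true → D q = true) : 𝒜.PolynomiallyAmbiguous :=
  ⟨Polynomial.X + 2, fun w => by
    simpa using 𝒜.ncard_acceptingRuns_le_of_phase D hI hM hD w⟩

theorem finitelyAmbiguous_countAutomaton (a b : A) : (countAutomaton S a b).FinitelyAmbiguous :=
  ⟨_, ncard_acceptingRuns_le_of_diagonal _ fun c p q h => by
    by_contra hpq
    simp [countAutomaton, hpq] at h⟩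

theorem polynomiallyAmbiguous_cutAutomaton (a b : A) :
    (cutAutomaton S a b).PolynomiallyAmbiguous :=
  polynomiallyAmbiguous_of_phase _ id (fun _ _ _ _ h => h) (fun _ _ _ _ _ _ h => h)
    fun c p q h hp => by
      obtain rfl : p = true := hp
      cases q
      · simp [cutAutomaton] at h
      · rfl

theorem polynomiallyAmbiguous_blockAutomaton (b : A) :
    (blockAutomaton S b).PolynomiallyAmbiguous := by
  refine polynomiallyAmbiguous_of_phase _ Prod.fst ?_ ?_ ?_
  · intro p q hp hq _
    simp only [blockAutomaton, ne_eq, ite_eq_right_iff, Classical.not_imp] at hp hq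
    rw [hp.1, hq.1]
  · rintro c ⟨p₁, p₂⟩ ⟨q₁, q₂⟩ ⟨r₁, r₂⟩ hq hr h
    obtain rfl : q₁ = r₁ := h
    by_cases hc : c = b <;> cases p₁ <;> cases p₂ <;> cases q₁ <;> cases q₂ <;> cases r₂ <;>
      simp_all [blockAutomaton]
  · rintro c ⟨p₁, p₂⟩ ⟨q₁, q₂⟩ h hp
    obtain rfl : p₁ = true := hp
    cases q₁
    · cases p₂ <;> simp [blockAutomaton] at h
    · rfl

end WeightedAutomaton

open WeightedAutomaton

/-! ### Values are bounded by the length of the word -/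

section Lengths

variable {A : Type*} [DecidableEq A] {S : Type*} [CommSemiring S] [TropicalLike S]

theorem val_countSum_le (a b : A) (w : List A) : val (countSum S a b w) ≤ w.length := by
  rcases add_selective ((gen : S) ^ w.count a) (gen ^ w.count b) with h | h <;>
    rw [countSum, h, val_gen_pow] <;> exact List.count_le_length

theorem val_cutSum_le (a b : A) (w : List A) : val (cutSum S a b w) ≤ w.length := by
  obtain ⟨i, -, h⟩ := exists_val_sum_gen_pow (S := S)
    (s := Finset.range (w.length + 1)) ⟨0, by simp⟩ (cut a b w)
  rw [cutSum, h, cut]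
  calc (w.take i).count a + (w.drop i).count b ≤ (w.take i).length + (w.drop i).length :=
        Nat.add_le_add List.count_le_length List.count_le_length
    _ = w.length := by rw [← List.length_append, List.take_append_drop]

omit [DecidableEq A] in
theorem length_le_of_mem_splitOnP (p : A → Bool) (w : List A) :
    ((w.splitOnP p).map List.length).sum ≤ w.length := by
  induction w with
  | nil => simp
  | cons c w ih =>
    rw [List.splitOnP_cons_eq_if_modifyHead]
    obtain ⟨u, r, e⟩ := List.exists_cons_of_ne_nil (List.splitOnP_ne_nil p w)
    rw [e] at ih ⊢
    simp only [List.map_cons, List.sum_cons] at ih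
    split_ifs <;> simp <;> omega

theorem val_blockSum_le (b : A) (w : List A) (h : blockSum S b w ≠ 0) :
    val (blockSum S b w) ≤ w.length := by
  obtain ⟨n, hn, e⟩ := exists_sum_eq _ h
  rw [blockSum, e, val_gen_pow]
  have h1 := List.mem_toFinset.mp (Finset.mem_of_mem_erase hn)
  exact (List.le_sum_of_mem h1).trans (length_le_of_mem_splitOnP _ w)

theorem val_splitProd_le (h : A) {f : List A → S}
    (hf : ∀ w, f w ≠ 0 → val (f w) ≤ w.length) (w : List A) (hw : splitProd h f w ≠ 0) :
    val (splitProd h f w) ≤ w.length := by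
  refine le_trans ?_ (length_le_of_mem_splitOnP (· == h) w)
  rw [splitProd, List.splitOn_eq_splitOnP] at hw ⊢
  generalize w.splitOnP (· == h) = l at hw ⊢
  induction l with
  | nil => exact val_one.le
  | cons u l ih =>
    simp only [List.map_cons, List.prod_cons, List.sum_cons] at hw ⊢
    have h1 : f u ≠ 0 := fun h0 => hw (by rw [h0, zero_mul])
    have h2 : (l.map f).prod ≠ 0 := fun h0 => hw (by rw [h0, mul_zero])
    rw [val_mul h1 h2]
    exact Nat.add_le_add (hf u h1) (ih h2)

end Lengths

/-! ### Values on words made of blocks -/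

section Values

variable {A : Type*} [DecidableEq A] {S : Type*} [CommSemiring S] [TropicalLike S]

theorem countSum_replicate_append {a b : A} (hab : a ≠ b) (x y : ℕ) :
    countSum S a b (List.replicate x a ++ List.replicate y b) = gen ^ x + gen ^ y := by
  simp [countSum, List.count_replicate, hab, hab.symm]

theorem blockSum_replicate {b : A} {x : ℕ} (hx : 0 < x) :
    blockSum S b (List.replicate x b) = gen ^ x := by
  rw [blockSum_eq, List.splitOnP_eq_singleton (by simp)]
  simp [blockTerm, hx.ne']

theorem blockSum_nil (b : A) : blockSum S b [] = 0 := by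
  rw [blockSum_eq]
  simp [blockTerm]

theorem blockSum_replicate_append_cons {b c : A} (hc : c ≠ b) {x : ℕ} (hx : 0 < x) (w : List A) :
    blockSum S b (List.replicate x b ++ c :: w) = gen ^ x + blockSum S b w := by
  rw [blockSum_eq, blockSum_eq,
    List.splitOnP_append_cons_of_forall_mem (by simp) c (by simpa using hc)]
  simp [blockTerm, hx.ne']

theorem gen_pow_count_add_cutSum (a b : A) (w : List A) :
    gen ^ w.count b + cutSum S a b w = cutSum S a b w := by
  have h := add_sum_of_mem (fun i => (gen : S) ^ cut a b w i)
    (Finset.mem_range.mpr (Nat.succ_pos w.length))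
  simpa [cut, cutSum] using h

theorem IsMinLike.gen_pow_add [IsMinLike S] {m n : ℕ} (h : m ≤ n) :
    (gen : S) ^ m + gen ^ n = gen ^ m := by
  obtain ⟨k, rfl⟩ := Nat.exists_eq_add_of_le h
  rw [pow_add, ← mul_one_add, IsMinLike.one_add_gen_pow, mul_one]

theorem IsMaxLike.gen_pow_add [IsMaxLike S] {m n : ℕ} (h : m ≤ n) :
    (gen : S) ^ m + gen ^ n = gen ^ n := by
  obtain ⟨k, rfl⟩ := Nat.exists_eq_add_of_le h
  rw [pow_add, ← mul_one_add, IsMaxLike.one_add_gen_pow]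

theorem IsMinLike.cutSum_replicate_append_right [IsMinLike S] {a b : A} (hab : a ≠ b) (x : ℕ)
    (w : List A) : cutSum S a b (List.replicate x b ++ w) = cutSum S a b w := by
  induction x with
  | zero => rfl
  | succ x ih =>
    rw [List.replicate_succ, List.cons_append, cutSum_cons, letterWeight, if_neg hab.symm, one_mul,
      ← gen_pow_count_add_cutSum, add_right_comm, IsMinLike.gen_pow_add List.count_le_count_cons,
      gen_pow_count_add_cutSum, ih]

/-- Only the cut before the `a`'s and the cuts after them matter: moving a cut into the `a`'s only
adds to the count. -/
theorem IsMinLike.cutSum_replicate_append_left [IsMinLike S] {a b : A} (hab : a ≠ b) (y : ℕ)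
    (w : List A) : cutSum S a b (List.replicate y a ++ w) =
      gen ^ w.count b + gen ^ y * cutSum S a b w := by
  induction y with
  | zero => simp [gen_pow_count_add_cutSum]
  | succ y ih =>
    have hc : (a :: (List.replicate y a ++ w)).count b = w.count b := by
      simp [List.count_append, List.count_replicate, hab]
    rw [List.replicate_succ, List.cons_append, cutSum_cons, letterWeight, if_pos rfl, ih, hc,
      mul_add, ← pow_succ', ← mul_assoc, ← pow_succ', add_right_comm, add_comm (gen ^ (_ + 1)),
      IsMinLike.gen_pow_add (Nat.le_succ _)]

/-- For the maximum, a cut inside the `b`'s is dominated by the cut before them. -/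
theorem IsMaxLike.cutSum_replicate_append_right [IsMaxLike S] {a b : A} (hab : a ≠ b) (x : ℕ)
    (w : List A) : cutSum S a b (List.replicate x b ++ w) =
      cutSum S a b w + gen ^ (x + w.count b) := by
  induction x with
  | zero => simp [add_comm (cutSum S a b w), gen_pow_count_add_cutSum]
  | succ x ih =>
    have hc : (b :: (List.replicate x b ++ w)).count b = x + 1 + w.count b := by
      simp [List.count_append]; ring
    rw [List.replicate_succ, List.cons_append, cutSum_cons, letterWeight, if_neg hab.symm, one_mul,
      ih, hc, add_assoc, IsMaxLike.gen_pow_add (by omega)]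

theorem IsMaxLike.cutSum_replicate_append_left [IsMaxLike S] {a b : A} (hab : a ≠ b) (y : ℕ)
    (w : List A) : cutSum S a b (List.replicate y a ++ w) = gen ^ y * cutSum S a b w := by
  induction y with
  | zero => simp
  | succ y ih =>
    have hc : (a :: (List.replicate y a ++ w)).count b = (List.replicate y a ++ w).count b := by
      simp [hab]
    rw [List.replicate_succ, List.cons_append, cutSum_cons, letterWeight, if_pos rfl, hc,
      ← gen_pow_count_add_cutSum, mul_add, ← pow_succ', add_right_comm, add_comm (gen ^ (_ + 1)),
      IsMaxLike.gen_pow_add (Nat.le_succ _), pow_succ' _ (List.count _ _), ← mul_add,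
      gen_pow_count_add_cutSum, ih, ← mul_assoc, ← pow_succ']

theorem IsMaxLike.cutSum_replicate_append [IsMaxLike S] {a b : A} (hab : a ≠ b) (x y : ℕ) :
    cutSum S a b (List.replicate x b ++ List.replicate y a) = gen ^ x + gen ^ y := by
  have h := IsMaxLike.cutSum_replicate_append_left (S := S) hab y []
  rw [List.append_nil, cutSum_nil, mul_one] at h
  rw [IsMaxLike.cutSum_replicate_append_right hab, h, List.count_replicate]
  simp [hab, add_comm]

omit [DecidableEq A] in
theorem length_blockWord_le {J : Type*} (js : List J) (α : J → A) {u : J → List A} {L : ℕ}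
    (hu : ∀ j, (u j).length ≤ L) (E : ℕ) :
    (blockWord js α u fun _ => E).length ≤ js.length * (E + L) := by
  induction js with
  | nil => simp [blockWord]
  | cons j js ih =>
    have := hu j
    rw [blockWord] at ih ⊢
    rw [List.flatMap_cons, List.length_append, List.length_cons, Nat.succ_mul]
    simp only [List.length_append, List.length_replicate]
    omega

/-- The pairs of an element of `Fin m` and a Boolean, in lexicographic order. -/
def pairs (m : ℕ) : List (Fin m × Bool) := List.finRange m ×ˢ [false, true]

theorem nodup_pairs (m : ℕ) : (pairs m).Nodup := (List.nodup_finRange m).product (by simp)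

theorem mem_pairs {m : ℕ} (j : Fin m × Bool) : j ∈ pairs m :=
  List.mem_product.mpr ⟨List.mem_finRange _, by cases j.2 <;> simp⟩

theorem length_pairs (m : ℕ) : (pairs m).length = m * 2 := by
  rw [pairs, List.length_product, List.length_finRange]
  rfl

omit [DecidableEq A] in
theorem blockWord_pairs (m : ℕ) (α : Fin m × Bool → A) (u : Fin m × Bool → List A)
    (e : Fin m × Bool → ℕ) :
    blockWord (pairs m) α u e = (List.finRange m).flatMap fun i =>
      List.replicate (e (i, false)) (α (i, false)) ++ (u (i, false) ++
        (List.replicate (e (i, true)) (α (i, true)) ++ u (i, true))) := by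
  change ((List.finRange m).flatMap fun i => [false, true].map (Prod.mk i)).flatMap _ = _
  rw [List.flatMap_assoc]
  simp

theorem blockSum_blockWord {a b : A} (hab : a ≠ b) (m : ℕ) (e : Fin m → ℕ) (he : ∀ i, 0 < e i) :
    blockSum S b (blockWord (List.finRange m) (fun _ => b) (fun _ => [a]) e) =
      ∑ i, gen ^ e i := by
  induction m with
  | zero => simp [blockWord, blockSum_nil]
  | succ m ih =>
    have h := ih (fun i => e i.succ) fun i => he _
    rw [blockWord] at h ⊢
    rw [List.finRange_succ, List.flatMap_cons, List.flatMap_map, List.append_assoc,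
      List.singleton_append, blockSum_replicate_append_cons hab (he 0), h, Fin.sum_univ_succ]

theorem count_blockWord_pairs {a b : A} (hab : a ≠ b) (m : ℕ) (x : Bool) (e : Fin m × Bool → ℕ) :
    (blockWord (pairs m) (fun j => if j.2 = x then b else a) (fun _ => []) e).count b =
      ∑ i, e (i, x) := by
  induction m with
  | zero => simp [blockWord_pairs]
  | succ m ih =>
    have h := ih fun j => e (j.1.succ, j.2)
    rw [blockWord_pairs] at h ⊢
    rw [List.finRange_succ, List.flatMap_cons, List.flatMap_map, List.count_append, h,
      Fin.sum_univ_succ]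
    cases x <;> simp [List.count_append, List.count_replicate, hab]

/-- Each `b`-block precedes its `a`-block, so optimal cuts lie between the two blocks of a pair and
omit both. The extra term is the cut at the end of the word, kept to make the induction start at the
empty word. -/
theorem IsMinLike.cutSum_blockWord_add [IsMinLike S] {a b : A} (hab : a ≠ b) (m : ℕ)
    (e : Fin m × Bool → ℕ) :
    cutSum S a b (blockWord (pairs m) (fun j => if j.2 = false then b else a) (fun _ => []) e) =
      ∑ i, gen ^ (∑ j, if j ≠ i then e (j, decide (j < i)) else 0) +
        gen ^ ∑ j, e (j, true) := by
  induction m with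
  | zero => simp [blockWord_pairs, cutSum_nil]
  | succ m ih =>
    have h := ih fun j => e (j.1.succ, j.2)
    have hc := count_blockWord_pairs hab m false fun j => e (j.1.succ, j.2)
    rw [blockWord_pairs] at h hc ⊢
    rw [List.finRange_succ, List.flatMap_cons, List.flatMap_map]
    simp only [List.nil_append, List.append_nil, if_true, Bool.true_eq_false, if_false,
      List.append_assoc] at h hc ⊢
    rw [IsMinLike.cutSum_replicate_append_right hab, IsMinLike.cutSum_replicate_append_left hab, h,
      hc, Fin.sum_univ_succ (fun i => gen ^ _), mul_add, Finset.mul_sum, ← pow_add, add_assoc]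
    congr 1
    · simp [Fin.sum_univ_succ]
    · congr 1
      · refine Finset.sum_congr rfl fun i _ => ?_
        rw [← pow_add, Fin.sum_univ_succ]
        simp [(Fin.succ_ne_zero i).symm]
      · rw [Fin.sum_univ_succ]

theorem IsMinLike.cutSum_blockWord [IsMinLike S] {a b : A} (hab : a ≠ b) (m : ℕ)
    (e : Fin (m + 1) × Bool → ℕ) :
    cutSum S a b
        (blockWord (pairs (m + 1)) (fun j => if j.2 = false then b else a) (fun _ => []) e) =
      ∑ i, gen ^ (∑ j, if j ≠ i then e (j, decide (j < i)) else 0) := by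
  -- The cut in the last pair is at least as good as the cut at the end.
  rw [IsMinLike.cutSum_blockWord_add hab, ← add_sum_of_mem _ (Finset.mem_univ (Fin.last m)),
    add_right_comm, IsMinLike.gen_pow_add (Finset.sum_le_sum fun j _ => ?_)]
  split_ifs with h
  · rw [decide_eq_true (lt_of_le_of_ne (Fin.le_last j) h)]
  · exact Nat.zero_le _

/-- Here the `a`-block comes first in each pair, so an optimal cut between the two blocks of pair
`i` collects both. -/
theorem IsMaxLike.cutSum_blockWord_add [IsMaxLike S] {a b : A} (hab : a ≠ b) (m : ℕ)
    (e : Fin m × Bool → ℕ) :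
    cutSum S a b (blockWord (pairs m) (fun j => if j.2 = true then b else a) (fun _ => []) e) =
      ∑ i, gen ^ (e (i, true) + ∑ j, e (j, decide (i < j))) + gen ^ ∑ j, e (j, false) := by
  induction m with
  | zero => simp [blockWord_pairs, cutSum_nil]
  | succ m ih =>
    have h := ih fun j => e (j.1.succ, j.2)
    have hc := count_blockWord_pairs hab m true fun j => e (j.1.succ, j.2)
    rw [blockWord_pairs] at h hc ⊢
    rw [List.finRange_succ, List.flatMap_cons, List.flatMap_map]
    simp only [List.nil_append, List.append_nil, if_true, Bool.false_eq_true, if_false,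
      List.append_assoc] at h hc ⊢
    rw [IsMaxLike.cutSum_replicate_append_left hab, IsMaxLike.cutSum_replicate_append_right hab, h,
      hc, Fin.sum_univ_succ (fun i => gen ^ _), add_comm _ (gen ^ _), mul_add, mul_add,
      Finset.mul_sum, ← pow_add, ← pow_add, add_assoc]
    congr 1
    · congr 1
      simp [Fin.sum_univ_succ]
      omega
    · congr 1
      · refine Finset.sum_congr rfl fun i _ => ?_
        rw [← pow_add, Fin.sum_univ_succ]
        congr 1
        simp
        omega
      · rw [Fin.sum_univ_succ]

theorem IsMaxLike.cutSum_blockWord [IsMaxLike S] {a b : A} (hab : a ≠ b) (m : ℕ)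
    (e : Fin (m + 1) × Bool → ℕ) :
    cutSum S a b
        (blockWord (pairs (m + 1)) (fun j => if j.2 = true then b else a) (fun _ => []) e) =
      ∑ i, gen ^ (e (i, true) + ∑ j, e (j, decide (i < j))) := by
  rw [IsMaxLike.cutSum_blockWord_add hab, ← add_sum_of_mem _ (Finset.mem_univ (Fin.last m)),
    add_right_comm, add_comm (gen ^ _) (gen ^ _), IsMaxLike.gen_pow_add]
  refine le_add_left (Finset.sum_le_sum fun j _ => ?_)
  rw [decide_eq_false (not_lt.mpr (Fin.le_last j))]

omit [TropicalLike S] in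
theorem splitProd_of_notMem {h : A} (f : List A → S) {w : List A} (hw : h ∉ w) :
    splitProd h f w = f w := by
  simp [splitProd, List.splitOn_eq_singleton hw]

omit [TropicalLike S] in
theorem splitProd_append_cons {h : A} (f : List A → S) {u : List A} (hu : h ∉ u) (w : List A) :
    splitProd h f (u ++ h :: w) = f u * splitProd h f w := by
  simp [splitProd, List.splitOn_append_cons_self, List.splitOn_eq_singleton hu]

omit [TropicalLike S] in
theorem splitProd_blockWord (h : A) (f : List A → S) (c : Bool → A) (v : List A)
    (hc : ∀ x, h ≠ c x) (hv : h ∉ v) (k : ℕ) (e : Fin (k + 1) × Bool → ℕ) :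
    splitProd h f (blockWord (pairs (k + 1)) (fun j => c j.2)
        (fun j => if j.2 = false then v else if j.1 = Fin.last k then [] else [h]) e) =
      ∏ i, f (List.replicate (e (i, false)) (c false) ++
        (v ++ List.replicate (e (i, true)) (c true))) := by
  have hn : ∀ x y, h ∉ List.replicate x (c false) ++ (v ++ List.replicate y (c true)) := by
    simp [List.mem_replicate, hc, hv]
  induction k with
  | zero =>
    rw [blockWord_pairs, Fin.prod_univ_one, ← splitProd_of_notMem f (hn _ _)]
    simp [List.finRange_succ]
  | succ k ih =>
    have hk := ih fun j => e (j.1.succ, j.2)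
    rw [blockWord_pairs] at hk ⊢
    rw [List.finRange_succ, List.flatMap_cons, List.flatMap_map, Fin.prod_univ_succ, ← hk,
      ← splitProd_append_cons f (hn _ _)]
    simp only [if_true, Bool.true_eq_false, if_false, ← Fin.succ_last, Fin.succ_inj,
      (Fin.succ_ne_zero _).symm, List.append_assoc, List.singleton_append]

end Values

/-! ### From pumped runs to lower bounds on ambiguity -/

namespace WeightedAutomaton

variable {A S Q : Type*} [CommSemiring S] [TropicalLike S] [Fintype Q]

/-- If `𝒜` outputs the sum over `i` of the powers of `gen` by the total length of the blocks in
`T i`, then it has at least as many runs as there are `i`, on the word whose blocks are all long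
compared with the number of blocks and with `C`. -/
structure HasPumpedRuns (𝒜 : WeightedAutomaton A S Q) (C : ℕ) : Prop where
  card_le_ncard : ∀ {J ι : Type} [Fintype J] [DecidableEq J] [Fintype ι] {js : List J}, js.Nodup →
    (∀ j, j ∈ js) → ∀ {α : J → A} {u : J → List A} {T : ι → Finset J} {r : ℕ},
    (∀ i, (T i).card = r) → Function.Injective T →
    (∀ e : J → ℕ, (∀ j, 0 < e j) →
      𝒜.output (blockWord js α u e) = ∑ i, (gen : S) ^ ∑ j ∈ T i, e j) →
    ∀ {s : ℕ}, C + ∑ j, (Fintype.card Q + 1 + (u j).length + C) <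
      s * (Fintype.card Q).factorial →
    Fintype.card ι ≤ (𝒜.acceptingRuns (blockWord js α u fun _ =>
      Fintype.card Q + 1 + s * (Fintype.card Q).factorial)).ncard

theorem hasPumpedRuns_of_min [IsMinLike S] (𝒜 : WeightedAutomaton A S Q) :
    𝒜.HasPumpedRuns 0 := by
  constructor
  intro J ι _ _ _ js hnd hjs α u T r hcard hinj hval s hs
  -- The bound on `r` comes from the size of some `T i`, so at least one index is needed.
  rcases isEmpty_or_nonempty ι with h | ⟨⟨i⟩⟩
  · simp
  · refine card_le_ncard_acceptingRuns_of_min hnd hjs hcard hinj hval (lt_of_le_of_lt ?_ hs)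
    rw [zero_add]
    calc r * (Fintype.card Q + 1) ≤ Fintype.card J * (Fintype.card Q + 1) :=
          Nat.mul_le_mul_right _ (hcard i ▸ Finset.card_le_univ _)
      _ = ∑ _j : J, (Fintype.card Q + 1) := by simp
      _ ≤ _ := Finset.sum_le_sum fun j _ => by omega

theorem exists_hasPumpedRuns_of_max [IsMaxLike S] {𝒜 : WeightedAutomaton A S Q}
    (hlen : ∀ w, 𝒜.output w ≠ 0 → val (𝒜.output w) ≤ w.length) : ∃ C, 𝒜.HasPumpedRuns C := by
  obtain ⟨C, hC⟩ := exists_costBound hlen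
  refine ⟨C, ⟨?_⟩⟩
  intro J ι _ _ _ js hnd hjs α u T r hcard hinj hval s hs
  exact card_le_ncard_acceptingRuns_of_max hC hnd hjs hcard hinj hval hs

variable {𝒜 : WeightedAutomaton A S Q}

theorem HasPumpedRuns.exists_card_le_ncard {C : ℕ} (hC : 𝒜.HasPumpedRuns C) {J ι : Type}
    [Fintype J] [DecidableEq J] [Fintype ι] {js : List J} (hnd : js.Nodup) (hjs : ∀ j, j ∈ js)
    {α : J → A} {u : J → List A} {T : ι → Finset J} {r : ℕ} (hcard : ∀ i, (T i).card = r)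
    (hinj : Function.Injective T)
    (hval : ∀ e : J → ℕ, (∀ j, 0 < e j) →
      𝒜.output (blockWord js α u e) = ∑ i, (gen : S) ^ ∑ j ∈ T i, e j) :
    ∃ w, Fintype.card ι ≤ (𝒜.acceptingRuns w).ncard :=
  ⟨_, hC.card_le_ncard hnd hjs hcard hinj hval ((Nat.lt_succ_self _).trans_le
    (Nat.le_mul_of_pos_right _ (Nat.factorial_pos _)))⟩

variable [DecidableEq A]

theorem HasPumpedRuns.not_unambiguous {C : ℕ} (hC : 𝒜.HasPumpedRuns C) {a b : A} (hab : a ≠ b)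
    (h : ∀ w, countSum S a b w = 𝒜.output w) : ¬ 𝒜.Unambiguous := by
  intro hu
  obtain ⟨w, hw⟩ := hC.exists_card_le_ncard (js := [false, true]) (by simp)
    (fun j => by cases j <;> simp) (α := fun j => cond j b a) (u := fun _ => [])
    (T := fun j : Bool => {j}) (r := 1) (fun _ => rfl) Finset.singleton_injective
    (fun e _ => by
      rw [← h, blockWord]
      simp [countSum_replicate_append hab, add_comm])
  have := hw.trans (hu w)
  simp at this

omit [TropicalLike S] [Fintype Q] [DecidableEq A] in
theorem not_finitelyAmbiguous_of_forall (h : ∀ m : ℕ, ∃ w, m < (𝒜.acceptingRuns w).ncard) :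
    ¬ 𝒜.FinitelyAmbiguous := by
  rintro ⟨N, hN⟩
  obtain ⟨w, hw⟩ := h N
  exact (hN w).not_gt hw

theorem HasPumpedRuns.not_finitelyAmbiguous_of_blockSum {C : ℕ} (hC : 𝒜.HasPumpedRuns C) {a b : A}
    (hab : a ≠ b) (h : ∀ w, blockSum S b w = 𝒜.output w) : ¬ 𝒜.FinitelyAmbiguous :=
  not_finitelyAmbiguous_of_forall fun m => by
    obtain ⟨w, hw⟩ := hC.exists_card_le_ncard (List.nodup_finRange (m + 1)) List.mem_finRange
      (α := fun _ => b) (u := fun _ => [a]) (T := fun j : Fin (m + 1) => {j}) (r := 1)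
      (fun _ => rfl) Finset.singleton_injective
      (fun e he => by simp [← h, blockSum_blockWord hab _ e he])
    exact ⟨w, by simpa using hw⟩

theorem not_finitelyAmbiguous_of_cutSum_of_min [IsMinLike S] {a b : A}
    (hab : a ≠ b) (h : ∀ w, cutSum S a b w = 𝒜.output w) : ¬ 𝒜.FinitelyAmbiguous :=
  not_finitelyAmbiguous_of_forall fun m => by
    let g (i : Fin (m + 1)) : Fin (m + 1) ↪ Fin (m + 1) × Bool :=
      ⟨fun j => (j, decide (j < i)), fun _ _ h => congrArg Prod.fst h⟩
    obtain ⟨w, hw⟩ := 𝒜.hasPumpedRuns_of_min.exists_card_le_ncard (nodup_pairs (m + 1)) mem_pairs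
      (α := fun j => if j.2 = false then b else a) (u := fun _ => [])
      (T := fun i : Fin (m + 1) => (Finset.univ.erase i).map (g i)) (r := m)
      (fun i => by simp)
      -- The index `i` is the only one at which `T i` contains neither block of the pair.
      (fun i l hil => by
        change (Finset.univ.erase i).map (g i) = (Finset.univ.erase l).map (g l) at hil
        by_contra hne
        have h1 : (i, decide (i < l)) ∈ (Finset.univ.erase l).map (g l) :=
          Finset.mem_map_of_mem (g l) (Finset.mem_erase.mpr ⟨hne, Finset.mem_univ _⟩)
        rw [← hil] at h1
        obtain ⟨j, hj, e⟩ := Finset.mem_map.mp h1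
        exact Finset.ne_of_mem_erase hj (congrArg Prod.fst e))
      (fun e _ => by
        rw [← h, IsMinLike.cutSum_blockWord hab]
        refine Finset.sum_congr rfl fun i _ => ?_
        rw [Finset.sum_map, ← Finset.filter_ne', Finset.sum_filter]
        rfl)
    exact ⟨w, by simpa using hw⟩

theorem HasPumpedRuns.not_finitelyAmbiguous_of_cutSum_of_max [IsMaxLike S] {C : ℕ}
    (hC : 𝒜.HasPumpedRuns C) {a b : A}
    (hab : a ≠ b) (h : ∀ w, cutSum S a b w = 𝒜.output w) : ¬ 𝒜.FinitelyAmbiguous :=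
  not_finitelyAmbiguous_of_forall fun m => by
    let g (i : Fin (m + 1)) : Fin (m + 1) ↪ Fin (m + 1) × Bool :=
      ⟨fun j => (j, decide (i < j)), fun _ _ h => congrArg Prod.fst h⟩
    have hg : ∀ i l x, (l, x) ∈ Finset.univ.map (g i) ↔ x = decide (i < l) := fun i l x => by
      refine ⟨fun h => ?_, fun e => Finset.mem_map.mpr ⟨l, Finset.mem_univ l, by rw [e]; rfl⟩⟩
      obtain ⟨j, -, e⟩ := Finset.mem_map.mp h
      obtain ⟨rfl, e2⟩ := Prod.mk.inj e
      exact e2.symm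
    have hn : ∀ i, (i, true) ∉ Finset.univ.map (g i) := fun i hi => by simp [hg] at hi
    obtain ⟨w, hw⟩ := hC.exists_card_le_ncard (nodup_pairs (m + 1)) mem_pairs
      (α := fun j => if j.2 = true then b else a) (u := fun _ => [])
      (T := fun i : Fin (m + 1) => insert (i, true) (Finset.univ.map (g i))) (r := m + 2)
      (fun i => by rw [Finset.card_insert_of_notMem (hn i)]; simp)
      -- The index `i` is the only one at which `T i` contains both blocks of the pair.
      (fun i l hil => by
        change insert (i, true) (Finset.univ.map (g i)) = insert (l, true) _ at hil
        by_contra hne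
        have h1 : (i, true) ∈ insert (l, true) (Finset.univ.map (g l)) := by
          rw [← hil]
          exact Finset.mem_insert_self _ _
        have h2 : (i, false) ∈ insert (l, true) (Finset.univ.map (g l)) := by
          rw [← hil]
          exact Finset.mem_insert_of_mem (by simp [hg])
        rw [Finset.mem_insert, hg, Prod.mk.injEq] at h1 h2
        simp only [hne, false_and, false_or] at h1 h2
        exact Bool.noConfusion (h1.trans h2.symm))
      (fun e _ => by
        rw [← h, IsMaxLike.cutSum_blockWord hab]
        refine Finset.sum_congr rfl fun i _ => ?_
        rw [Finset.sum_insert (hn i), Finset.sum_map]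
        rfl)
    exact ⟨w, by rw [Fintype.card_fin] at hw; exact hw⟩

theorem exists_eval_lt_two_pow (p : Polynomial ℕ) : ∃ k, p.eval k < 2 ^ (k + 1) := by
  have key : (fun k : ℕ => ((p.eval k : ℕ) : ℝ)) =o[Filter.atTop] fun k : ℕ => (2 : ℝ) ^ k := by
    induction p using Polynomial.induction_on' with
    | add p q hp hq => simpa using hp.add hq
    | monomial n c =>
      simpa using (isLittleO_pow_const_const_pow_of_one_lt (R := ℝ) n one_lt_two).const_mul_left c
  obtain ⟨k, hk⟩ := (key.bound one_pos).exists
  refine ⟨k, ?_⟩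
  rw [one_mul, Real.norm_of_nonneg (by positivity), Real.norm_of_nonneg (by positivity)] at hk
  have : p.eval k ≤ 2 ^ k := by exact_mod_cast hk
  exact this.trans_lt (Nat.pow_lt_pow_right one_lt_two (Nat.lt_succ_self k))

theorem eval_mono (p : Polynomial ℕ) {m n : ℕ} (h : m ≤ n) : p.eval m ≤ p.eval n := by
  rw [Polynomial.eval_eq_sum_range, Polynomial.eval_eq_sum_range]
  gcongr

/-- Expanding a product of `k + 1` binomials gives `2 ^ (k + 1)` terms, one for each choice of a
block in every piece, and distinct choices are distinct sets of size `k + 1`. -/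
theorem HasPumpedRuns.not_polynomiallyAmbiguous {C : ℕ} (hC : 𝒜.HasPumpedRuns C) {h : A}
    {f : List A → S} {c : Bool → A} {v : List A} (hc : ∀ x, h ≠ c x) (hv : h ∉ v)
    (hf : ∀ x y, 0 < x → 0 < y → f (List.replicate x (c false) ++
      (v ++ List.replicate y (c true))) = gen ^ x + gen ^ y)
    (hout : ∀ w, splitProd h f w = 𝒜.output w) : ¬ 𝒜.PolynomiallyAmbiguous := by
  rintro ⟨p, hp⟩
  set n := Fintype.card Q with hn
  -- The pumping factor `B * (k + 1)` is linear in `k` because there are `2 * (k + 1)` blocks; the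
  -- word length is then a polynomial in `k` that depends only on the automaton and `v`.
  set B := 2 * (n + 1 + (v.length + 1) + C) + C + 1 with hB
  obtain ⟨k, hk⟩ := exists_eval_lt_two_pow (p.comp ((Polynomial.X + 1) * 2 *
    (Polynomial.C (n + 1) + (Polynomial.C B * (Polynomial.X + 1)) * Polynomial.C n.factorial
      + Polynomial.C (v.length + 1))))
  simp only [Polynomial.eval_comp, Polynomial.eval_mul, Polynomial.eval_add, Polynomial.eval_X,
    Polynomial.eval_one, Polynomial.eval_ofNat, Polynomial.eval_C] at hk
  let g (σ : Fin (k + 1) → Bool) : Fin (k + 1) ↪ Fin (k + 1) × Bool :=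
    ⟨fun j => (j, σ j), fun _ _ h => congrArg Prod.fst h⟩
  let u : Fin (k + 1) × Bool → List A :=
    fun j => if j.2 = false then v else if j.1 = Fin.last k then [] else [h]
  have hu : ∀ j, (u j).length ≤ v.length + 1 := fun j => by
    simp only [u]
    split_ifs <;> simp
  have hs : C + ∑ j, (n + 1 + (u j).length + C) < B * (k + 1) * n.factorial := by
    calc C + ∑ j, (n + 1 + (u j).length + C)
        ≤ C + ∑ _j : Fin (k + 1) × Bool, (n + 1 + (v.length + 1) + C) := by
          gcongr with j
          exact hu j
      _ = C + (k + 1) * (2 * (n + 1 + (v.length + 1) + C)) := by simp; ring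
      _ < B * (k + 1) := by rw [hB]; nlinarith
      _ ≤ _ := Nat.le_mul_of_pos_right _ (Nat.factorial_pos _)
  have hruns := hC.card_le_ncard (nodup_pairs (k + 1)) mem_pairs (α := fun j => c j.2) (u := u)
    (T := fun σ : Fin (k + 1) → Bool => Finset.univ.map (g σ)) (r := k + 1)
    (fun σ => by simp)
    (fun σ σ' hσ => by
      change Finset.univ.map (g σ) = Finset.univ.map (g σ') at hσ
      funext i
      have h1 : (i, σ i) ∈ Finset.univ.map (g σ') := by
        rw [← hσ]
        exact Finset.mem_map_of_mem (g σ) (Finset.mem_univ i)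
      obtain ⟨j, -, e⟩ := Finset.mem_map.mp h1
      obtain ⟨rfl, e2⟩ := Prod.mk.inj e
      exact e2.symm)
    (fun e he => by
      rw [← hout, splitProd_blockWord h f c v hc hv,
        Finset.prod_congr rfl fun i _ => (hf _ _ (he _) (he _)).trans (add_comm _ _)]
      have h1 := Finset.prod_univ_sum (fun _ : Fin (k + 1) => (Finset.univ : Finset Bool))
        (fun i x => (gen : S) ^ e (i, x))
      simp only [Fintype.sum_bool, Fintype.piFinset_univ] at h1
      rw [h1]
      refine Finset.sum_congr rfl fun σ _ => ?_
      rw [Finset.sum_map, Finset.prod_pow_eq_pow_sum]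
      rfl) hs
  have hlen := length_blockWord_le (pairs (k + 1)) (fun j => c j.2) hu
    (n + 1 + B * (k + 1) * n.factorial)
  rw [length_pairs] at hlen
  have h2 := (hruns.trans (hp _)).trans (eval_mono p hlen)
  simp only [Fintype.card_pi, Fintype.card_bool, Finset.prod_const, Finset.card_univ,
    Fintype.card_fin] at h2
  exact absurd (h2.trans_lt hk) (lt_irrefl _)

end WeightedAutomaton

/-! ### Membership and non-membership in the four classes -/

section Classes

variable {A S : Type*} [CommSemiring S]

theorem UWA_subset_FAWA : UWA A S ⊆ FAWA A S := by
  rintro f ⟨Q, _, 𝒜, h, hf⟩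
  exact ⟨Q, _, 𝒜, ⟨1, h⟩, hf⟩

theorem FAWA_subset_PAWA : FAWA A S ⊆ PAWA A S := by
  rintro f ⟨Q, _, 𝒜, ⟨N, h⟩, hf⟩
  exact ⟨Q, _, 𝒜, ⟨Polynomial.C N, by simpa using h⟩, hf⟩

theorem PAWA_subset_WA : PAWA A S ⊆ WA A S := by
  rintro f ⟨Q, _, 𝒜, -, hf⟩
  exact ⟨Q, _, 𝒜, hf⟩

variable [DecidableEq A]

theorem splitProd_mem_WA (h : A) {f : List A → S} (hf : f ∈ WA A S) : splitProd h f ∈ WA A S := by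
  obtain ⟨Q, _, 𝒜, hf⟩ := hf
  obtain rfl : f = 𝒜.output := funext hf
  exact ⟨Q, _, 𝒜.restart h, fun w => (output_restart h 𝒜 w).symm⟩

variable [TropicalLike S]

theorem countSum_mem_FAWA (a b : A) : countSum S a b ∈ FAWA A S :=
  ⟨Bool, _, _, finitelyAmbiguous_countAutomaton a b, fun w => (output_countAutomaton a b w).symm⟩

theorem cutSum_mem_PAWA (a b : A) : cutSum S a b ∈ PAWA A S :=
  ⟨Bool, _, _, polynomiallyAmbiguous_cutAutomaton a b, fun w => (output_cutAutomaton a b w).symm⟩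

theorem blockSum_mem_PAWA (b : A) : blockSum S b ∈ PAWA A S :=
  ⟨Bool × Bool, _, _, polynomiallyAmbiguous_blockAutomaton b,
    fun w => (output_blockAutomaton b w).symm⟩

variable {a b h : A}

theorem IsMinLike.countSum_notMem_UWA [IsMinLike S] (hab : a ≠ b) : countSum S a b ∉ UWA A S := by
  rintro ⟨Q, _, 𝒜, hu, hf⟩
  exact 𝒜.hasPumpedRuns_of_min.not_unambiguous hab hf hu

theorem IsMinLike.cutSum_notMem_FAWA [IsMinLike S] (hab : a ≠ b) : cutSum S a b ∉ FAWA A S := by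
  rintro ⟨Q, _, 𝒜, hu, hf⟩
  exact not_finitelyAmbiguous_of_cutSum_of_min hab hf hu

theorem IsMinLike.blockSum_notMem_FAWA [IsMinLike S] (hab : a ≠ b) : blockSum S b ∉ FAWA A S := by
  rintro ⟨Q, _, 𝒜, hu, hf⟩
  exact 𝒜.hasPumpedRuns_of_min.not_finitelyAmbiguous_of_blockSum hab hf hu

theorem IsMinLike.splitProd_countSum_notMem_PAWA [IsMinLike S] (hab : a ≠ b) (hah : a ≠ h)
    (hbh : b ≠ h) : splitProd h (countSum S a b) ∉ PAWA A S := by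
  rintro ⟨Q, _, 𝒜, hu, hf⟩
  refine 𝒜.hasPumpedRuns_of_min.not_polynomiallyAmbiguous (c := fun x => cond x b a) (v := [])
    (fun x => ?_) (by simp) (fun x y _ _ => countSum_replicate_append hab x y) hf hu
  cases x
  exacts [hah.symm, hbh.symm]

theorem IsMinLike.splitProd_blockSum_notMem_PAWA [IsMinLike S] (hab : a ≠ b) (hah : a ≠ h)
    (hbh : b ≠ h) : splitProd h (blockSum S b) ∉ PAWA A S := by
  rintro ⟨Q, _, 𝒜, hu, hf⟩
  refine 𝒜.hasPumpedRuns_of_min.not_polynomiallyAmbiguous (c := fun _ => b) (v := [a])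
    (fun _ => hbh.symm) (by simpa using hah.symm) (fun x y hx hy => ?_) hf hu
  rw [List.singleton_append, blockSum_replicate_append_cons hab hx, blockSum_replicate hy]

theorem IsMaxLike.countSum_notMem_UWA [IsMaxLike S] (hab : a ≠ b) : countSum S a b ∉ UWA A S := by
  rintro ⟨Q, _, 𝒜, hu, hf⟩
  obtain ⟨C, hC⟩ := exists_hasPumpedRuns_of_max (𝒜 := 𝒜)
    fun w _ => hf w ▸ val_countSum_le a b w
  exact hC.not_unambiguous hab hf hu

theorem IsMaxLike.cutSum_notMem_FAWA [IsMaxLike S] (hab : a ≠ b) : cutSum S a b ∉ FAWA A S := by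
  rintro ⟨Q, _, 𝒜, hu, hf⟩
  obtain ⟨C, hC⟩ := exists_hasPumpedRuns_of_max (𝒜 := 𝒜)
    fun w _ => hf w ▸ val_cutSum_le a b w
  exact hC.not_finitelyAmbiguous_of_cutSum_of_max hab hf hu

theorem IsMaxLike.blockSum_notMem_FAWA [IsMaxLike S] (hab : a ≠ b) : blockSum S b ∉ FAWA A S := by
  rintro ⟨Q, _, 𝒜, hu, hf⟩
  obtain ⟨C, hC⟩ := exists_hasPumpedRuns_of_max (𝒜 := 𝒜)
    fun w hw => by rw [← hf w] at hw ⊢; exact val_blockSum_le b w hw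
  exact hC.not_finitelyAmbiguous_of_blockSum hab hf hu

theorem IsMaxLike.splitProd_countSum_notMem_PAWA [IsMaxLike S] (hab : a ≠ b) (hah : a ≠ h)
    (hbh : b ≠ h) : splitProd h (countSum S a b) ∉ PAWA A S := by
  rintro ⟨Q, _, 𝒜, hu, hf⟩
  obtain ⟨C, hC⟩ := exists_hasPumpedRuns_of_max (𝒜 := 𝒜) fun w hw => by
    rw [← hf w] at hw ⊢
    exact val_splitProd_le h (fun w _ => val_countSum_le a b w) w hw
  refine hC.not_polynomiallyAmbiguous (c := fun x => cond x b a) (v := [])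
    (fun x => ?_) (by simp) (fun x y _ _ => countSum_replicate_append hab x y) hf hu
  cases x
  exacts [hah.symm, hbh.symm]

theorem IsMaxLike.splitProd_cutSum_notMem_PAWA [IsMaxLike S] (hab : a ≠ b) (hah : a ≠ h)
    (hbh : b ≠ h) : splitProd h (cutSum S a b) ∉ PAWA A S := by
  rintro ⟨Q, _, 𝒜, hu, hf⟩
  obtain ⟨C, hC⟩ := exists_hasPumpedRuns_of_max (𝒜 := 𝒜) fun w hw => by
    rw [← hf w] at hw ⊢
    exact val_splitProd_le h (fun w _ => val_cutSum_le a b w) w hw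
  refine hC.not_polynomiallyAmbiguous (c := fun x => cond x a b) (v := [])
    (fun x => ?_) (by simp) (fun x y _ _ => IsMaxLike.cutSum_replicate_append hab x y) hf hu
  cases x
  exacts [hbh.symm, hah.symm]

end Classes

end WeightedAut

theorem mainTheorem6 {A : Type*} [Fintype A] [DecidableEq A] :
    -- the inclusions, over every finite alphabet
    (UWA A MinPlus ⊆ FAWA A MinPlus ∧ FAWA A MinPlus ⊆ PAWA A MinPlus ∧
      PAWA A MinPlus ⊆ WA A MinPlus) ∧
    (UWA A MaxPlus ⊆ FAWA A MaxPlus ∧ FAWA A MaxPlus ⊆ PAWA A MaxPlus ∧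
      PAWA A MaxPlus ⊆ WA A MaxPlus) ∧
    -- the separating functions that need two letters
    (∀ a b : A, a ≠ b →
      (toMin (f₂ a b) ∈ FAWA A MinPlus ∧ toMin (f₂ a b) ∉ UWA A MinPlus) ∧
      (toMin (f₃ a b) ∈ PAWA A MinPlus ∧ toMin (f₃ a b) ∉ FAWA A MinPlus) ∧
      (toMin (f₄ b) ∈ PAWA A MinPlus ∧ toMin (f₄ b) ∉ FAWA A MinPlus) ∧
      (toMax (g₂ a b) ∈ FAWA A MaxPlus ∧ toMax (g₂ a b) ∉ UWA A MaxPlus) ∧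
      (toMax (g₃ a b) ∈ PAWA A MaxPlus ∧ toMax (g₃ a b) ∉ FAWA A MaxPlus) ∧
      (toMax (g₄ b) ∈ PAWA A MaxPlus ∧ toMax (g₄ b) ∉ FAWA A MaxPlus)) ∧
    -- the separating functions that need three letters
    (∀ a b h : A, a ≠ b → a ≠ h → b ≠ h →
      (toMin (f₅ a b h) ∈ WA A MinPlus ∧ toMin (f₅ a b h) ∉ PAWA A MinPlus) ∧
      (toMin (f₆ b h) ∈ WA A MinPlus ∧ toMin (f₆ b h) ∉ PAWA A MinPlus) ∧
      (toMax (g₅ a b h) ∈ WA A MaxPlus ∧ toMax (g₅ a b h) ∉ PAWA A MaxPlus) ∧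
      (toMax (g₆ a b h) ∈ WA A MaxPlus ∧ toMax (g₆ a b h) ∉ PAWA A MaxPlus)) ∧
    -- the strict hierarchy
    (2 ≤ Fintype.card A →
      (UWA A MinPlus ⊂ FAWA A MinPlus ∧ FAWA A MinPlus ⊂ PAWA A MinPlus) ∧
      (UWA A MaxPlus ⊂ FAWA A MaxPlus ∧ FAWA A MaxPlus ⊂ PAWA A MaxPlus)) ∧
    (3 ≤ Fintype.card A →
      (UWA A MinPlus ⊂ FAWA A MinPlus ∧ FAWA A MinPlus ⊂ PAWA A MinPlus ∧
        PAWA A MinPlus ⊂ WA A MinPlus) ∧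
      (UWA A MaxPlus ⊂ FAWA A MaxPlus ∧ FAWA A MaxPlus ⊂ PAWA A MaxPlus ∧
        PAWA A MaxPlus ⊂ WA A MaxPlus)) := by
  have two : ∀ a b : A, a ≠ b →
      (toMin (f₂ a b) ∈ FAWA A MinPlus ∧ toMin (f₂ a b) ∉ UWA A MinPlus) ∧
      (toMin (f₃ a b) ∈ PAWA A MinPlus ∧ toMin (f₃ a b) ∉ FAWA A MinPlus) ∧
      (toMin (f₄ b) ∈ PAWA A MinPlus ∧ toMin (f₄ b) ∉ FAWA A MinPlus) ∧
      (toMax (g₂ a b) ∈ FAWA A MaxPlus ∧ toMax (g₂ a b) ∉ UWA A MaxPlus) ∧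
      (toMax (g₃ a b) ∈ PAWA A MaxPlus ∧ toMax (g₃ a b) ∉ FAWA A MaxPlus) ∧
      (toMax (g₄ b) ∈ PAWA A MaxPlus ∧ toMax (g₄ b) ∉ FAWA A MaxPlus) := by
    intro a b hab
    rw [toMin_f₂, toMin_f₃, toMin_f₄, toMax_g₂, toMax_g₃, toMax_g₄]
    exact ⟨⟨countSum_mem_FAWA a b, IsMinLike.countSum_notMem_UWA hab⟩,
      ⟨cutSum_mem_PAWA a b, IsMinLike.cutSum_notMem_FAWA hab⟩,
      ⟨blockSum_mem_PAWA b, IsMinLike.blockSum_notMem_FAWA hab⟩,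
      ⟨countSum_mem_FAWA a b, IsMaxLike.countSum_notMem_UWA hab⟩,
      ⟨cutSum_mem_PAWA a b, IsMaxLike.cutSum_notMem_FAWA hab⟩,
      ⟨blockSum_mem_PAWA b, IsMaxLike.blockSum_notMem_FAWA hab⟩⟩
  have three : ∀ a b h : A, a ≠ b → a ≠ h → b ≠ h →
      (toMin (f₅ a b h) ∈ WA A MinPlus ∧ toMin (f₅ a b h) ∉ PAWA A MinPlus) ∧
      (toMin (f₆ b h) ∈ WA A MinPlus ∧ toMin (f₆ b h) ∉ PAWA A MinPlus) ∧
      (toMax (g₅ a b h) ∈ WA A MaxPlus ∧ toMax (g₅ a b h) ∉ PAWA A MaxPlus) ∧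
      (toMax (g₆ a b h) ∈ WA A MaxPlus ∧ toMax (g₆ a b h) ∉ PAWA A MaxPlus) := by
    intro a b h hab hah hbh
    rw [toMin_f₅, toMin_f₆, toMax_g₅, toMax_g₆]
    exact ⟨⟨splitProd_mem_WA h (PAWA_subset_WA (FAWA_subset_PAWA (countSum_mem_FAWA a b))),
        IsMinLike.splitProd_countSum_notMem_PAWA hab hah hbh⟩,
      ⟨splitProd_mem_WA h (PAWA_subset_WA (blockSum_mem_PAWA b)),
        IsMinLike.splitProd_blockSum_notMem_PAWA hab hah hbh⟩,
      ⟨splitProd_mem_WA h (PAWA_subset_WA (FAWA_subset_PAWA (countSum_mem_FAWA a b))),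
        IsMaxLike.splitProd_countSum_notMem_PAWA hab hah hbh⟩,
      ⟨splitProd_mem_WA h (PAWA_subset_WA (cutSum_mem_PAWA a b)),
        IsMaxLike.splitProd_cutSum_notMem_PAWA hab hah hbh⟩⟩
  have ssub : ∀ {S : Type} {X Y : Set (List A → S)} {f : List A → S}, X ⊆ Y → f ∈ Y ∧ f ∉ X →
      X ⊂ Y := fun hXY hf => (Set.ssubset_iff_of_subset hXY).mpr ⟨_, hf⟩
  have strict : 2 ≤ Fintype.card A →
      (UWA A MinPlus ⊂ FAWA A MinPlus ∧ FAWA A MinPlus ⊂ PAWA A MinPlus) ∧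
      (UWA A MaxPlus ⊂ FAWA A MaxPlus ∧ FAWA A MaxPlus ⊂ PAWA A MaxPlus) := by
    intro hA
    obtain ⟨a, b, hab⟩ := Fintype.one_lt_card_iff.mp hA
    obtain ⟨h1, h2, -, h3, h4, -⟩ := two a b hab
    exact ⟨⟨ssub UWA_subset_FAWA h1, ssub FAWA_subset_PAWA h2⟩,
      ssub UWA_subset_FAWA h3, ssub FAWA_subset_PAWA h4⟩
  refine ⟨⟨UWA_subset_FAWA, FAWA_subset_PAWA, PAWA_subset_WA⟩,
    ⟨UWA_subset_FAWA, FAWA_subset_PAWA, PAWA_subset_WA⟩, two, three, strict, fun hA => ?_⟩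
  obtain ⟨a, b, h, hab, hah, hbh⟩ := Fintype.two_lt_card_iff.mp hA
  obtain ⟨h1, -, h2, -⟩ := three a b h hab hah hbh
  obtain ⟨⟨k1, k2⟩, k3, k4⟩ := strict (by omega)
  exact ⟨⟨k1, k2, ssub PAWA_subset_WA h1⟩, k3, k4, ssub PAWA_subset_WA h2⟩
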